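/- Let $\Omega\subset\mathbb R^d$ be open, $Q=\Omega\times(0,1)$, and let $H:(0,1)\times\Omega\times\mathbb R^d\to\mathbb R$ be measurable in $(x,t)$ for each fixed $p$ and convex and differentiable in $p$ for each fixed $(t,x)$; assume that $H(\cdot,\cdot,\bar p)\in L^2(Q)$ for at least one $\bar p\in L^2(Q;\mathbb R^d)$. Put $L(t,x,v)=\sup_{p}\{-v\cdot p-H(t,x,p)\}\in(-\infty,+\infty]$. Let $\rho_0\in L^2(\Omega)$ and let $\zeta_1,\dots,\zeta_r\in C^2(\Omega)\cap L^2(\Omega)$ be orthonormal in $L^2(\Omega)$. Let $\mathcal G=L^2(Q)\times L^2(Q;\mathbb R^d)\times L^2(\Omega)\times L^2(\Omega)$, with elements $u=(\rho,m,\rho(\cdot,0),\rho(\cdot,1))$ (the last two components are independent variables) and pairing $$\langle \hat u,u\rangle=\int_0^1\!\!\int_\Omega(\hat\rho\rho+\hat m\cdot m)\,dx\,dt+\int_\Omega\hat\rho(x,0)\rho(x,0)\,dx+\int_\Omega\hat\rho(x,1)\rho(x,1)\,dx .$$ Let $\Xi(u)=\int_0^1\int_\Omega \rho\,L(t,x,m/\rho)\,dx\,dt$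 (integrand $0$ where $\rho=0$) if $\rho(\cdot,0)=\rho_0$, $\rho\ge 0$ a.e. on $Q$ and $m=0$ a.e. where $\rho=0$, and $\Xi(u)=+\infty$ otherwise. Let $\Xi^*(\hat u)=\sup_{u\in\mathcal G}\{\langle\hat u,u\rangle-\Xi(u)\}$. Subdifferentials are taken with respect to $\langle\cdot,\cdot\rangle$ and are empty where the function is not finite. For $(a,b,\alpha,\beta,\phi)\in L^2(0,1)^r\times\mathbb R^r\times L^2(Q)\times L^2(\Omega)\times H^1(Q)$, with $\phi(\cdot,0),\phi(\cdot,1)\in L^2(\Omega)$ the traces of $\phi$, set $$\begin{aligned}\Psi(a,b,\alpha,\beta,\phi)=\inf_{u\in\mathcal G}\Big\{&\Xi(u)+\int_0^1\!\!\int_\Omega\Big(\alpha+\sum_i a_i(t)\zeta_i(x)\Big)\rho\,dx\,dt+\int_\Omega\Big(\beta+\sum_i b_i\zeta_i\Big)\rho(x,1)\,dx\\&+\int_0^1\!\!\int_\Omega(\phi_t\rho+\nabla\phi\cdot m)\,dx\,dt-\int_\Omega\phi(x,1)\rho(x,1)\,dx+\int_\Omega\phi(x,0)\rho(x,0)\,dx\Big\},\end{aligned}$$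 and let $C$ be the linear operator $$C(a,b,\alpha,\beta,\phi)=\Big(-\sum_i a_i\zeta_i-\alpha-\phi_t,\ -\nabla\phi,\ -\phi(\cdot,0),\ -\sum_i b_i\zeta_i-\beta+\phi(\cdot,1)\Big)\in\mathcal G .$$ Consider the system $$(\ast)\qquad -\phi_t+H(t,x,\nabla\phi)=\alpha+\sum_i a_i\zeta_i,\quad m=-\rho\nabla_pH(t,x,\nabla\phi),\quad \rho(\cdot,0)=\rho_0,\quad \phi(\cdot,1)=\beta+\sum_i b_i\zeta_i \quad\text{a.e.}$$ Then for every $(a,b,\alpha,\beta,\phi)$ and every $u=(\rho,m,\rho(\cdot,0),\rho(\cdot,1))\in\mathcal G$: 1. If $\rho\ge0$ a.e. and $(\ast)$ holds, then $u$ attains the infimum in $\Psi(a,b,\alpha,\beta,\phi)$. If $\rho>0$ a.e. on $Q$, then $(\ast)$ holds if and only if $u$ attains this infimum. In general, $u$ attains the infimum if and only if $\rho\ge 0$ a.e. and $(\ast)$ holds with its first equation replaced by $-\phi_t+H(t,x,\nabla\phi)\le\alpha+\sum_i a_i\zeta_i$ a.e. on $Q$, with equality a.e. on $\{\rho>0\}$.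 2. $\Psi(a,b,\alpha,\beta,\phi)=-\Xi^*(C(a,b,\alpha,\beta,\phi))$. 3. $u$ attains the infimum if and only if $C(a,b,\alpha,\beta,\phi)\in\partial\Xi(u)$, and if and only if $u\in\partial\Xi^*(C(a,b,\alpha,\beta,\phi))$. -/

import Mathlib

open MeasureTheory Set
open scoped ENNReal ContDiff Gradient

noncomputable section

namespace MFG

/-! ### Domains and Lebesgue spaces -/

/-- The ambient space `ℝ^d` with its Euclidean norm. -/
abbrev Space (d : ℕ) := EuclideanSpace ℝ (Fin d)

/-- Lebesgue measure on `Ω`. -/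
abbrev spaceMeasure {d : ℕ} (Ω : Set (Space d)) : Measure (Space d) := volume.restrict Ω

/-- Lebesgue measure on the time interval `(0,1)`. -/
abbrev timeMeasure : Measure ℝ := volume.restrict (Ioo (0 : ℝ) 1)

/-- Lebesgue measure on the cylinder `Q = Ω × (0,1)`; its points are written `z = (x, t)`. -/
abbrev cylMeasure {d : ℕ} (Ω : Set (Space d)) : Measure (Space d × ℝ) :=
  (spaceMeasure Ω).prod timeMeasure

/-- `L²(0,1)`. -/
abbrev L2T := Lp ℝ 2 timeMeasure

/-- `L²(Ω)`. -/
abbrev L2X {d : ℕ} (Ω : Set (Space d)) := Lp ℝ 2 (spaceMeasure Ω)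

/-- `L²(Q)`. -/
abbrev L2Q {d : ℕ} (Ω : Set (Space d)) := Lp ℝ 2 (cylMeasure Ω)

/-- `L²(Q; ℝ^d)`. -/
abbrev L2QV {d : ℕ} (Ω : Set (Space d)) := Lp (Space d) 2 (cylMeasure Ω)

instance : IsProbabilityMeasure timeMeasure := ⟨by simp⟩

/-! ### Three linear maps between the Lebesgue spaces -/

section LinearMaps

variable {d : ℕ} {Ω : Set (Space d)}

theorem memLp_tensor (a : L2T) {ζ : Space d → ℝ} (hζ : MemLp ζ 2 (spaceMeasure Ω)) :
    MemLp (fun z : Space d × ℝ => a z.2 * ζ z.1) 2 (cylMeasure Ω) := by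
  have ha : MemLp a 2 timeMeasure := Lp.memLp a
  have hm : AEStronglyMeasurable (fun z : Space d × ℝ => a z.2 * ζ z.1) (cylMeasure Ω) :=
    ha.aestronglyMeasurable.comp_snd.mul hζ.aestronglyMeasurable.comp_fst
  rw [memLp_two_iff_integrable_sq hm]
  have h := Integrable.mul_prod hζ.integrable_sq ha.integrable_sq
  refine h.congr (Filter.Eventually.of_forall fun z => ?_)
  ring

/-- The map `a ↦ a(t) ζ(x)` from `L²(0,1)` to `L²(Q)`, for a fixed `ζ ∈ L²(Ω)`. -/
def tensor {ζ : Space d → ℝ} (hζ : MemLp ζ 2 (spaceMeasure Ω)) : L2T →ₗ[ℝ] L2Q Ω where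
  toFun a := (memLp_tensor a hζ).toLp _
  map_add' a a' := by
    rw [← MemLp.toLp_add, MemLp.toLp_eq_toLp_iff]
    have h := Measure.quasiMeasurePreserving_snd (μ := spaceMeasure Ω) (ν := timeMeasure)
      |>.ae (Lp.coeFn_add a a')
    filter_upwards [h] with z hz
    simp only [Pi.add_apply] at hz ⊢
    rw [hz]; ring
  map_smul' c a := by
    rw [RingHom.id_apply, ← MemLp.toLp_const_smul, MemLp.toLp_eq_toLp_iff]
    have h := Measure.quasiMeasurePreserving_snd (μ := spaceMeasure Ω) (ν := timeMeasure)
      |>.ae (Lp.coeFn_smul c a)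
    filter_upwards [h] with z hz
    simp only [Pi.smul_apply, smul_eq_mul] at hz ⊢
    rw [hz]; ring

theorem ae_mem_Ioo : ∀ᵐ z ∂(cylMeasure Ω), z.2 ∈ Ioo (0 : ℝ) 1 :=
  Measure.quasiMeasurePreserving_snd (μ := spaceMeasure Ω) (ν := timeMeasure)
    |>.ae (ae_restrict_mem measurableSet_Ioo)

theorem memLp_mulTime (c : ℝ) (f : L2Q Ω) :
    MemLp (fun z : Space d × ℝ => (z.2 - c) * f z) 2 (cylMeasure Ω) := by
  have hf : MemLp f 2 (cylMeasure Ω) := Lp.memLp f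
  refine MemLp.of_le_mul (c := 1 + |c|) hf ?_ ?_
  · exact (by fun_prop : Continuous fun z : Space d × ℝ => z.2 - c).aestronglyMeasurable.mul
      hf.aestronglyMeasurable
  · filter_upwards [ae_mem_Ioo (Ω := Ω)] with z hz
    rw [norm_mul]
    gcongr
    rw [Real.norm_eq_abs]
    calc |z.2 - c| ≤ |z.2| + |c| := abs_sub _ _
      _ ≤ 1 + |c| := by gcongr; rw [abs_of_pos hz.1]; exact hz.2.le

/-- The map `f ↦ (t - c) f(x,t)` on `L²(Q)`. -/
def mulTime (c : ℝ) : L2Q Ω →ₗ[ℝ] L2Q Ω where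
  toFun f := (memLp_mulTime c f).toLp _
  map_add' f g := by
    rw [← MemLp.toLp_add, MemLp.toLp_eq_toLp_iff]
    filter_upwards [Lp.coeFn_add f g] with z hz
    simp only [Pi.add_apply] at hz ⊢
    rw [hz]; ring
  map_smul' k f := by
    rw [RingHom.id_apply, ← MemLp.toLp_const_smul, MemLp.toLp_eq_toLp_iff]
    filter_upwards [Lp.coeFn_smul k f] with z hz
    simp only [Pi.smul_apply, smul_eq_mul] at hz ⊢
    rw [hz]; ring

theorem memLp_slice (f : L2Q Ω) :
    ∀ᵐ x ∂(spaceMeasure Ω), MemLp (fun t => f (x, t)) 2 timeMeasure := by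
  have hf : MemLp f 2 (cylMeasure Ω) := Lp.memLp f
  filter_upwards [hf.aestronglyMeasurable.prodMk_left, hf.integrable_sq.prod_right_ae]
    with x hx hx2
  exact (memLp_two_iff_integrable_sq hx).2 hx2

theorem memLp_timeIntegral (f : L2Q Ω) :
    MemLp (fun x => ∫ t, f (x, t) ∂timeMeasure) 2 (spaceMeasure Ω) := by
  have hf : MemLp f 2 (cylMeasure Ω) := Lp.memLp f
  have hm : AEStronglyMeasurable (fun x => ∫ t, f (x, t) ∂timeMeasure) (spaceMeasure Ω) :=
    hf.aestronglyMeasurable.integral_prod_right'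
  rw [memLp_two_iff_integrable_sq hm]
  refine Integrable.mono' hf.integrable_sq.integral_prod_left (hm.pow 2) ?_
  filter_upwards [memLp_slice f] with x hx
  set c := ∫ t, f (x, t) ∂timeMeasure with hc
  have h1 : Integrable (fun t => f (x, t)) timeMeasure := hx.integrable (by norm_num)
  have h2 : Integrable (fun t => f (x, t) ^ 2) timeMeasure := hx.integrable_sq
  have h0 : 0 ≤ ∫ t, (f (x, t) - c) ^ 2 ∂timeMeasure := integral_nonneg fun t => sq_nonneg _
  have he : ∫ t, (f (x, t) - c) ^ 2 ∂timeMeasure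
      = (∫ t, f (x, t) ^ 2 ∂timeMeasure) - c ^ 2 := by
    have : (fun t => (f (x, t) - c) ^ 2)
        = fun t => f (x, t) ^ 2 - (2 * c) * f (x, t) + c ^ 2 := by funext t; ring
    rw [this]
    have i1 := integral_add (μ := timeMeasure) (f := fun t => f (x, t) ^ 2 - (2 * c) * f (x, t))
      (g := fun _ => c ^ 2) (h2.sub (h1.const_mul _)) (integrable_const _)
    rw [i1, integral_sub h2 (h1.const_mul _), integral_const_mul, ← hc]
    simp
    ring
  rw [Real.norm_of_nonneg (sq_nonneg c)]
  linarith

/-- The map `f ↦ ∫₀¹ f(·,t) dt` from `L²(Q)` to `L²(Ω)`. -/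
def timeIntegral : L2Q Ω →ₗ[ℝ] L2X Ω where
  toFun f := (memLp_timeIntegral f).toLp _
  map_add' f g := by
    rw [← MemLp.toLp_add, MemLp.toLp_eq_toLp_iff]
    filter_upwards [Measure.ae_ae_of_ae_prod (Lp.coeFn_add f g), memLp_slice f, memLp_slice g]
      with x hx hf hg
    rw [Pi.add_apply, ← integral_add (hf.integrable (by norm_num)) (hg.integrable (by norm_num))]
    exact integral_congr_ae hx
  map_smul' k f := by
    rw [RingHom.id_apply, ← MemLp.toLp_const_smul, MemLp.toLp_eq_toLp_iff]
    filter_upwards [Measure.ae_ae_of_ae_prod (Lp.coeFn_smul k f)] with x hx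
    rw [Pi.smul_apply, smul_eq_mul, ← integral_const_mul]
    exact integral_congr_ae hx

end LinearMaps

/-! ### The Sobolev space `H¹(Q)` and the traces at the initial and terminal times -/

theorem integrable_mul_of_compact {d : ℕ} {Ω : Set (Space d)} (f : L2Q Ω)
    {g : Space d × ℝ → ℝ} (hg : Continuous g) (hc : HasCompactSupport g) :
    Integrable (fun z => f z * g z) (cylMeasure Ω) :=
  MemLp.integrable_mul (p := 2) (q := 2) (Lp.memLp f) (hg.memLp_of_hasCompactSupport hc)

/-- The smooth compactly supported test functions on the open cylinder `Ω × (0,1)`. -/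
def IsTestFunction {d : ℕ} (Ω : Set (Space d)) (ψ : Space d × ℝ → ℝ) : Prop :=
  ContDiff ℝ ∞ ψ ∧ HasCompactSupport ψ ∧ tsupport ψ ⊆ Ω ×ˢ Ioo (0 : ℝ) 1

/-- `H¹(Q)`, as the space of triples `(φ, φ_t, ∇φ)` in `L²(Q) × L²(Q) × L²(Q; ℝ^d)` in which
`φ_t` is the weak time derivative of `φ` and `∇φ` its weak gradient in `x`; the last two are
determined by `φ`. -/
def H1 {d : ℕ} (Ω : Set (Space d)) : Submodule ℝ (L2Q Ω × L2Q Ω × L2QV Ω) where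
  carrier := {f | ∀ ψ : Space d × ℝ → ℝ, IsTestFunction Ω ψ →
    (∫ z, f.1 z * fderiv ℝ ψ z (0, 1) ∂(cylMeasure Ω)
        = -∫ z, f.2.1 z * ψ z ∂(cylMeasure Ω)) ∧
    ∀ e : Space d, ∫ z, f.1 z * fderiv ℝ ψ z (e, 0) ∂(cylMeasure Ω)
        = -∫ z, inner ℝ (f.2.2 z) e * ψ z ∂(cylMeasure Ω)}
  zero_mem' := by
    intro ψ _
    have h0 := Lp.coeFn_zero ℝ 2 (cylMeasure Ω)
    have h0' := Lp.coeFn_zero (Space d) 2 (cylMeasure Ω)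
    have key : ∀ g : Space d × ℝ → ℝ,
        ∫ z, (0 : L2Q Ω) z * g z ∂(cylMeasure Ω) = 0 := fun g =>
      integral_eq_zero_of_ae (by filter_upwards [h0] with z hz; rw [hz]; simp)
    refine ⟨?_, fun e => ?_⟩
    · simp only [Prod.fst_zero, Prod.snd_zero, key, neg_zero]
    · simp only [Prod.fst_zero, Prod.snd_zero, key]
      rw [integral_eq_zero_of_ae (by filter_upwards [h0'] with z hz; rw [hz]; simp), neg_zero]
  add_mem' := by
    intro f g hf hg ψ hψ
    have hd : ∀ v : Space d × ℝ, Continuous (fun z => fderiv ℝ ψ z v) ∧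
        HasCompactSupport (fun z => fderiv ℝ ψ z v) := fun v =>
      ⟨(hψ.1.continuous_fderiv (by simp)).clm_apply continuous_const,
        hψ.2.1.fderiv_apply ℝ v⟩
    have add1 : ∀ (a b : L2Q Ω) (k : Space d × ℝ → ℝ), Continuous k → HasCompactSupport k →
        ∫ z, (a + b) z * k z ∂(cylMeasure Ω)
          = (∫ z, a z * k z ∂(cylMeasure Ω)) + ∫ z, b z * k z ∂(cylMeasure Ω) := by
      intro a b k hk hk'
      rw [← integral_add (integrable_mul_of_compact a hk hk') (integrable_mul_of_compact b hk hk')]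
      refine integral_congr_ae ?_
      filter_upwards [Lp.coeFn_add a b] with z hz
      rw [hz, Pi.add_apply, add_mul]
    refine ⟨?_, fun e => ?_⟩
    · simp only [Prod.fst_add, Prod.snd_add]
      rw [add1 _ _ _ (hd _).1 (hd _).2, add1 _ _ _ hψ.1.continuous hψ.2.1,
        (hf ψ hψ).1, (hg ψ hψ).1]
      ring
    · simp only [Prod.fst_add, Prod.snd_add]
      rw [add1 _ _ _ (hd _).1 (hd _).2, (hf ψ hψ).2 e, (hg ψ hψ).2 e]
      have hi : ∀ a : L2QV Ω,
          Integrable (fun z => inner ℝ (a z) e * ψ z) (cylMeasure Ω) := fun a =>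
        MemLp.integrable_mul (p := 2) (q := 2) ((Lp.memLp a).inner_const e)
          (hψ.1.continuous.memLp_of_hasCompactSupport hψ.2.1)
      rw [← neg_add, ← integral_add (hi _) (hi _)]
      congr 1
      refine integral_congr_ae ?_
      filter_upwards [Lp.coeFn_add f.2.2 g.2.2] with z hz
      rw [hz, Pi.add_apply, inner_add_left, add_mul]
  smul_mem' := by
    intro c f hf ψ hψ
    have smul1 : ∀ (a : L2Q Ω) (k : Space d × ℝ → ℝ),
        ∫ z, (c • a) z * k z ∂(cylMeasure Ω) = c * ∫ z, a z * k z ∂(cylMeasure Ω) := by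
      intro a k
      rw [← integral_const_mul]
      refine integral_congr_ae ?_
      filter_upwards [Lp.coeFn_smul c a] with z hz
      rw [hz, Pi.smul_apply, smul_eq_mul, mul_assoc]
    refine ⟨?_, fun e => ?_⟩
    · simp only [Prod.smul_fst, Prod.smul_snd]
      rw [smul1, smul1, (hf ψ hψ).1]
      ring
    · simp only [Prod.smul_fst, Prod.smul_snd]
      rw [smul1, (hf ψ hψ).2 e, mul_neg, ← integral_const_mul]
      congr 1
      refine integral_congr_ae ?_
      filter_upwards [Lp.coeFn_smul c f.2.2] with z hz
      rw [hz, Pi.smul_apply, inner_smul_left, mul_assoc]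
      rfl

/-- The function `φ` itself. -/
def H1.val {d : ℕ} {Ω : Set (Space d)} : H1 Ω →ₗ[ℝ] L2Q Ω :=
  LinearMap.fst ℝ _ _ ∘ₗ (H1 Ω).subtype

/-- The weak time derivative `φ_t`. -/
def H1.dt {d : ℕ} {Ω : Set (Space d)} : H1 Ω →ₗ[ℝ] L2Q Ω :=
  LinearMap.fst ℝ _ _ ∘ₗ LinearMap.snd ℝ _ _ ∘ₗ (H1 Ω).subtype

/-- The weak gradient `∇φ` in the space variable. -/
def H1.grad {d : ℕ} {Ω : Set (Space d)} : H1 Ω →ₗ[ℝ] L2QV Ω :=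
  LinearMap.snd ℝ _ _ ∘ₗ LinearMap.snd ℝ _ _ ∘ₗ (H1 Ω).subtype

/-- The trace `φ(·,0) = ∫₀¹ ∂_t ((t-1) φ) dt = ∫₀¹ (φ + (t-1) φ_t) dt ∈ L²(Ω)`. -/
def H1.initial {d : ℕ} {Ω : Set (Space d)} : H1 Ω →ₗ[ℝ] L2X Ω :=
  timeIntegral ∘ₗ (H1.val + mulTime 1 ∘ₗ H1.dt)

/-- The trace `φ(·,1) = ∫₀¹ ∂_t (t φ) dt = ∫₀¹ (φ + t φ_t) dt ∈ L²(Ω)`. -/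
def H1.terminal {d : ℕ} {Ω : Set (Space d)} : H1 Ω →ₗ[ℝ] L2X Ω :=
  timeIntegral ∘ₗ (H1.val + mulTime 0 ∘ₗ H1.dt)

theorem timeIntegral_trace {d : ℕ} {Ω : Set (Space d)} (c : ℝ) (φ : H1 Ω)
    (f g : Space d × ℝ → ℝ)
    (hf : H1.val φ =ᵐ[cylMeasure Ω] f) (hg : H1.dt φ =ᵐ[cylMeasure Ω] g)
    (hcont : ∀ᵐ x ∂(spaceMeasure Ω), ContinuousOn (fun t => f (x, t)) (Icc 0 1))
    (hderiv : ∀ᵐ x ∂(spaceMeasure Ω), ∀ t ∈ Ioo (0 : ℝ) 1,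
      HasDerivAt (fun s => f (x, s)) (g (x, t)) t) :
    timeIntegral (H1.val φ + mulTime c (H1.dt φ)) =ᵐ[spaceMeasure Ω]
      fun x => (1 - c) * f (x, 1) - (0 - c) * f (x, 0) := by
  have h1 : (timeIntegral (H1.val φ + mulTime c (H1.dt φ)) : Space d → ℝ) =ᵐ[spaceMeasure Ω]
      fun x => ∫ t, (H1.val φ + mulTime c (H1.dt φ)) (x, t) ∂timeMeasure :=
    (memLp_timeIntegral _).coeFn_toLp
  have h2 : ((H1.val φ + mulTime c (H1.dt φ) : L2Q Ω) : Space d × ℝ → ℝ) =ᵐ[cylMeasure Ω]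
      fun z => f z + (z.2 - c) * g z := by
    have h3 : (mulTime c (H1.dt φ) : Space d × ℝ → ℝ) =ᵐ[cylMeasure Ω]
      fun z => (z.2 - c) * H1.dt φ z := (memLp_mulTime c _).coeFn_toLp
    filter_upwards [Lp.coeFn_add (H1.val φ) (mulTime c (H1.dt φ)), h3, hf, hg]
      with z hz h3z hfz hgz
    rw [hz, Pi.add_apply, h3z, hfz, hgz]
  filter_upwards [h1, Measure.ae_ae_of_ae_prod h2, hcont, hderiv,
    memLp_slice (H1.val φ + mulTime c (H1.dt φ))] with x hx1 hx2 hxc hxd hxm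
  rw [hx1, integral_congr_ae hx2]
  have hint : Integrable (fun t => f (x, t) + (t - c) * g (x, t)) timeMeasure :=
    (hxm.integrable (by norm_num)).congr hx2
  rw [← integral_Ioc_eq_integral_Ioo, ← intervalIntegral.integral_of_le zero_le_one]
  refine intervalIntegral.integral_eq_sub_of_hasDerivAt_of_le
    (f := fun t => (t - c) * f (x, t)) zero_le_one ?_ ?_ ?_
  · exact (by fun_prop : Continuous fun t : ℝ => t - c).continuousOn.mul hxc
  · intro t ht
    have := ((hasDerivAt_id t).sub_const c).mul (hxd t ht)
    simp only [id_eq, one_mul] at this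
    exact this
  · rw [intervalIntegrable_iff_integrableOn_Ioo_of_le zero_le_one]
    exact hint

/-- The two traces are the boundary values of every representative that is continuous in
`t ∈ [0,1]` and differentiable in `t ∈ (0,1)`. -/
theorem H1.trace_eq {d : ℕ} {Ω : Set (Space d)} (φ : H1 Ω) (f g : Space d × ℝ → ℝ)
    (hf : H1.val φ =ᵐ[cylMeasure Ω] f) (hg : H1.dt φ =ᵐ[cylMeasure Ω] g)
    (hcont : ∀ᵐ x ∂(spaceMeasure Ω), ContinuousOn (fun t => f (x, t)) (Icc 0 1))
    (hderiv : ∀ᵐ x ∂(spaceMeasure Ω), ∀ t ∈ Ioo (0 : ℝ) 1,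
      HasDerivAt (fun s => f (x, s)) (g (x, t)) t) :
    H1.initial φ =ᵐ[spaceMeasure Ω] (fun x => f (x, 0)) ∧
      H1.terminal φ =ᵐ[spaceMeasure Ω] fun x => f (x, 1) := by
  constructor
  · have h := timeIntegral_trace 1 φ f g hf hg hcont hderiv
    simp only [sub_self, zero_mul, zero_sub, neg_mul, one_mul, neg_neg] at h
    exact h
  · have h := timeIntegral_trace 0 φ f g hf hg hcont hderiv
    simp only [sub_zero, zero_mul, one_mul] at h
    exact h

/-! ### The Lagrangian and the action -/

/-- `L(t,x,v) = sup_p (-v·p - H(t,x,p))`. -/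
def lagrangian {d : ℕ} (H : ℝ → Space d → Space d → ℝ) (t : ℝ) (x v : Space d) : EReal :=
  ⨆ p : Space d, ((-(inner ℝ v p) - H t x p : ℝ) : EReal)

/-- The integral of an extended real function: integral of the positive part minus integral of
the negative part. -/
def extIntegral {X : Type*} [MeasurableSpace X] (μ : Measure X) (f : X → EReal) : EReal :=
  ((∫⁻ z, (f z).toENNReal ∂μ : ℝ≥0∞) : EReal) - ((∫⁻ z, (-f z).toENNReal ∂μ : ℝ≥0∞) : EReal)

/-- The space of the unknowns `(ρ, m, ρ(·,0), ρ(·,1))`; an element of `L²(Q)` has no boundary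
values in time, so that `ρ(·,0)` and `ρ(·,1)` are components of their own. -/
abbrev State {d : ℕ} (Ω : Set (Space d)) := L2Q Ω × L2QV Ω × L2X Ω × L2X Ω

/-- The density `ρ`. -/
abbrev State.rho {d : ℕ} {Ω : Set (Space d)} (u : State Ω) : L2Q Ω := u.1
/-- The flux `m`. -/
abbrev State.flux {d : ℕ} {Ω : Set (Space d)} (u : State Ω) : L2QV Ω := u.2.1
/-- The initial value `ρ(·,0)`. -/
abbrev State.rhoInit {d : ℕ} {Ω : Set (Space d)} (u : State Ω) : L2X Ω := u.2.2.1
/-- The terminal value `ρ(·,1)`. -/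
abbrev State.rhoTerm {d : ℕ} {Ω : Set (Space d)} (u : State Ω) : L2X Ω := u.2.2.2

/-- The pairing
`∫∫ (ρ̂ ρ + m̂·m) dx dt + ∫ ρ̂(x,0) ρ(x,0) dx + ∫ ρ̂(x,1) ρ(x,1) dx`. -/
def pairing {d : ℕ} {Ω : Set (Space d)} (q u : State Ω) : ℝ :=
  (∫ z, (q.rho z * u.rho z + inner ℝ (q.flux z) (u.flux z)) ∂(cylMeasure Ω))
    + (∫ x, q.rhoInit x * u.rhoInit x ∂(spaceMeasure Ω))
    + ∫ x, q.rhoTerm x * u.rhoTerm x ∂(spaceMeasure Ω)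

open Classical in
/-- `Ξ(ρ,m) = ∫∫ ρ L(t,x,m/ρ) dx dt` if `ρ(·,0) = ρ₀`, `ρ ≥ 0` and `m ≪ ρ` (for `ρ ≥ 0` this says
that `m = 0` a.e. where `ρ = 0`), and `+∞` otherwise. The integrand is `0` where `ρ = 0`, as
`0 * a = 0` for all `a : EReal`. -/
def action {d : ℕ} {Ω : Set (Space d)} (H : ℝ → Space d → Space d → ℝ) (ρ₀ : L2X Ω)
    (u : State Ω) : EReal :=
  if u.rhoInit = ρ₀ ∧ (∀ᵐ z ∂(cylMeasure Ω), 0 ≤ u.rho z) ∧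
      (∀ᵐ z ∂(cylMeasure Ω), u.rho z = 0 → u.flux z = 0) then
    extIntegral (cylMeasure Ω)
      (fun z => (u.rho z : EReal) * lagrangian H z.2 z.1 ((u.rho z)⁻¹ • u.flux z))
  else ⊤

/-- The convex conjugate `f*(q) = sup_u (⟨q,u⟩ - f(u))`. -/
def conjugate {d : ℕ} {Ω : Set (Space d)} (f : State Ω → EReal) (q : State Ω) : EReal :=
  ⨆ u : State Ω, ((pairing q u : ℝ) : EReal) - f u

/-- The subdifferential `∂f(u)`: all `q` with `f(w) ≥ f(u) + ⟨q, w - u⟩` for all `w`, where `f(u)`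
is finite; it is empty where `f(u)` is not finite. -/
def subdiff {d : ℕ} {Ω : Set (Space d)} (f : State Ω → EReal) (u : State Ω) : Set (State Ω) :=
  {q | f u ≠ ⊤ ∧ f u ≠ ⊥ ∧ ∀ w, f u + ((pairing q (w - u) : ℝ) : EReal) ≤ f w}

/-! ### The optimization problem, the operator `C` and the Hamilton–Jacobi system -/

/-- The space of `(a, b, α, β, φ)`, `L²_t × ℓ² × L²_{x,t} × L²_x × H¹_{x,t}`. -/
abbrev Param {d : ℕ} (Ω : Set (Space d)) (r : ℕ) :=
  (Fin r → L2T) × EuclideanSpace ℝ (Fin r) × L2Q Ω × L2X Ω × H1 Ω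

section Problem

variable {d r : ℕ} {Ω : Set (Space d)}

/-- The coefficients `a_i(t)`. -/
abbrev Param.a (s : Param Ω r) : Fin r → L2T := s.1
/-- The coefficients `b_i`. -/
abbrev Param.b (s : Param Ω r) : EuclideanSpace ℝ (Fin r) := s.2.1
/-- The function `α(x,t)`. -/
abbrev Param.alpha (s : Param Ω r) : L2Q Ω := s.2.2.1
/-- The function `β(x)`. -/
abbrev Param.beta (s : Param Ω r) : L2X Ω := s.2.2.2.1
/-- The function `φ(x,t)`. -/
abbrev Param.phi (s : Param Ω r) : H1 Ω := s.2.2.2.2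

/-- The objective that is minimized in the definition of `Ψ(a,b,α,β,φ)`. -/
def objective (H : ℝ → Space d → Space d → ℝ) (ρ₀ : L2X Ω) (ζ : Fin r → Space d → ℝ)
    (s : Param Ω r) (u : State Ω) : EReal :=
  action H ρ₀ u +
    (((∫ z, (s.alpha z + ∑ i, s.a i z.2 * ζ i z.1) * u.rho z ∂(cylMeasure Ω))
      + (∫ x, (s.beta x + ∑ i, s.b i * ζ i x) * u.rhoTerm x ∂(spaceMeasure Ω))
      + (∫ z, (H1.dt s.phi z * u.rho z + inner ℝ (H1.grad s.phi z) (u.flux z)) ∂(cylMeasure Ω))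
      - (∫ x, H1.terminal s.phi x * u.rhoTerm x ∂(spaceMeasure Ω))
      + ∫ x, H1.initial s.phi x * u.rhoInit x ∂(spaceMeasure Ω) : ℝ) : EReal)

/-- `Ψ(a,b,α,β,φ)`. -/
def Psi (H : ℝ → Space d → Space d → ℝ) (ρ₀ : L2X Ω) (ζ : Fin r → Space d → ℝ)
    (s : Param Ω r) : EReal :=
  ⨅ u : State Ω, objective H ρ₀ ζ s u

/-- `u` solves the optimization problem: it attains the infimum. -/
def IsSolution (H : ℝ → Space d → Space d → ℝ) (ρ₀ : L2X Ω) (ζ : Fin r → Space d → ℝ)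
    (s : Param Ω r) (u : State Ω) : Prop :=
  ∀ w : State Ω, objective H ρ₀ ζ s u ≤ objective H ρ₀ ζ s w

/-- The linear operator `C(a,b,α,β,φ) = (-∑ aᵢ(t) ζᵢ(x) - α - φ_t, -∇φ, -φ(·,0),
-∑ bᵢ ζᵢ(x) - β + φ(·,1))`. -/
def opC {ζ : Fin r → Space d → ℝ} (hζ : ∀ i, MemLp (ζ i) 2 (spaceMeasure Ω)) :
    Param Ω r →ₗ[ℝ] State Ω where
  toFun s :=
    (-(∑ i, tensor (hζ i) (s.a i)) - s.alpha - H1.dt s.phi,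
      -H1.grad s.phi,
      -H1.initial s.phi,
      -(∑ i, s.b i • (hζ i).toLp (ζ i)) - s.beta + H1.terminal s.phi)
  map_add' s s' := by
    obtain ⟨a, b, α, β, φ⟩ := s
    obtain ⟨a', b', α', β', φ'⟩ := s'
    dsimp only [Param.a, Param.b, Param.alpha, Param.beta, Param.phi]
    simp only [Prod.mk_add_mk, Pi.add_apply, map_add, PiLp.add_apply, add_smul,
      Finset.sum_add_distrib, Prod.mk.injEq]
    refine ⟨?_, ?_, ?_, ?_⟩ <;> abel
  map_smul' c s := by
    obtain ⟨a, b, α, β, φ⟩ := s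
    dsimp only [Param.a, Param.b, Param.alpha, Param.beta, Param.phi]
    simp only [Prod.smul_mk, Pi.smul_apply, map_smul, PiLp.smul_apply, smul_eq_mul, mul_smul,
      ← Finset.smul_sum, RingHom.id_apply, smul_sub, smul_add, smul_neg]

/-- The system
`-φ_t + H(t,x,∇φ) = α + ∑ aᵢ(t) ζᵢ(x)`, `m = -ρ ∇_p H(t,x,∇φ)`, `ρ(·,0) = ρ₀`,
`φ(·,1) = β + ∑ bᵢ ζᵢ`, with all equations almost everywhere. -/
def SolvesSystem (H : ℝ → Space d → Space d → ℝ) (ρ₀ : L2X Ω) (ζ : Fin r → Space d → ℝ)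
    (s : Param Ω r) (u : State Ω) : Prop :=
  (∀ᵐ z ∂(cylMeasure Ω), -H1.dt s.phi z + H z.2 z.1 (H1.grad s.phi z)
      = s.alpha z + ∑ i, s.a i z.2 * ζ i z.1) ∧
  (∀ᵐ z ∂(cylMeasure Ω), u.flux z = -(u.rho z • ∇ (H z.2 z.1) (H1.grad s.phi z))) ∧
  u.rhoInit = ρ₀ ∧
  (∀ᵐ x ∂(spaceMeasure Ω), H1.terminal s.phi x = s.beta x + ∑ i, s.b i * ζ i x)

/-- The same system, with the Hamilton–Jacobi equation as an inequality `≤` on `Q` that is an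
equality almost everywhere on `{ρ > 0}`. -/
def SolvesComplementaritySystem (H : ℝ → Space d → Space d → ℝ) (ρ₀ : L2X Ω)
    (ζ : Fin r → Space d → ℝ) (s : Param Ω r) (u : State Ω) : Prop :=
  (∀ᵐ z ∂(cylMeasure Ω), -H1.dt s.phi z + H z.2 z.1 (H1.grad s.phi z)
      ≤ s.alpha z + ∑ i, s.a i z.2 * ζ i z.1) ∧
  (∀ᵐ z ∂(cylMeasure Ω), 0 < u.rho z →
    -H1.dt s.phi z + H z.2 z.1 (H1.grad s.phi z) = s.alpha z + ∑ i, s.a i z.2 * ζ i z.1) ∧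
  (∀ᵐ z ∂(cylMeasure Ω), u.flux z = -(u.rho z • ∇ (H z.2 z.1) (H1.grad s.phi z))) ∧
  u.rhoInit = ρ₀ ∧
  (∀ᵐ x ∂(spaceMeasure Ω), H1.terminal s.phi x = s.beta x + ∑ i, s.b i * ζ i x)

end Problem

end MFG

end

open MFG

open Filter Topology

/-! ### Convex functions and measurability of compositions -/

/-! The operator `C` is built so that the objective equals `Ξ(u) - ⟨q,u⟩` with `q = C(a,b,α,β,φ)`
(`objective_eq`). Taking the infimum gives `Ψ = -Ξ*(q)`, and minimality of `u` means `q ∈ ∂Ξ(u)`,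
once `Ξ` is known to be proper (`action_ne_bot`, `action_zero_density`).

Everything else rests on Fenchel's inequality `ρ L(m/ρ) ≥ -m·p - ρ H(p)`, with equality when `m = -ρ
∇H(p)`. Taking `p = -m̂` and integrating shows that `Ξ*(q) = ⟨ρ̂(·,0), ρ₀⟩` if `ρ̂ + H(-m̂) ≤ 0`
a.e. and `ρ̂(·,1) = 0`. If either condition fails, scaling a suitable test state gives `Ξ*(q) = +∞`.

Optimality is encoded by the pointwise conditions `IsOptimalPair`, through a cycle of implications:
these conditions give equality in Fenchel's inequality, hence `q ∈ ∂Ξ(u)`; this gives `u ∈ ∂Ξ*(q)`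
for any function; and `u ∈ ∂Ξ*(q)` gives the conditions back by perturbing `q` inside the set where
`Ξ*` is explicit (`inner_flux_le_of_mem_subdiff_conjugate`). Closing the cycle this way needs
neither lower semicontinuity of `Ξ` nor a biconjugate theorem. The action is only bounded below, or
computed where the Lagrangian is explicit, so measurability of `L` is not needed either. -/

/-- The gradient inequality for a convex function. -/
theorem ConvexOn.add_inner_gradient_le {E : Type*} [NormedAddCommGroup E] [InnerProductSpace ℝ E]
    [CompleteSpace E] {f : E → ℝ} (hf : ConvexOn ℝ univ f) {x : E} (hd : DifferentiableAt ℝ f x)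
    (y : E) : f x + inner ℝ (∇ f x) (y - x) ≤ f y := by
  have hg : ConvexOn ℝ univ (fun t : ℝ => f (AffineMap.lineMap x y t)) := by
    have h := hf.comp_affineMap (AffineMap.lineMap x y : ℝ →ᵃ[ℝ] E)
    rwa [preimage_univ] at h
  have hderiv : HasDerivAt (fun t : ℝ => f (AffineMap.lineMap x y t)) (fderiv ℝ f x (y - x)) 0 := by
    have h1 : HasFDerivAt f (fderiv ℝ f x) ((AffineMap.lineMap x y : ℝ →ᵃ[ℝ] E) 0) := by
      rw [AffineMap.lineMap_apply_zero]; exact hd.hasFDerivAt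
    exact h1.comp_hasDerivAt (0 : ℝ) AffineMap.hasDerivAt_lineMap
  have h := hg.le_slope_of_hasDerivAt (mem_univ 0) (mem_univ 1) zero_lt_one hderiv
  rw [slope_def_field] at h
  simp only [AffineMap.lineMap_apply_zero, AffineMap.lineMap_apply_one, sub_zero, div_one] at h
  rw [inner_gradient_left]
  linarith

/-- If the difference quotients of `f` at `x` are bounded below by a linear functional, then that
functional is given by the gradient. -/
theorem eq_gradient_of_inner_le {E : Type*} [NormedAddCommGroup E] [InnerProductSpace ℝ E]
    [CompleteSpace E] {f : E → ℝ} {x v : E} (hd : DifferentiableAt ℝ f x)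
    (h : ∀ y, f x + inner ℝ v (y - x) ≤ f y) : v = ∇ f x := by
  have hmin : IsLocalMin (fun y => f y - inner ℝ v y) x := by
    refine Eventually.of_forall fun y => ?_
    have := h y
    rw [inner_sub_right] at this
    linarith
  have hf := hd.hasFDerivAt.sub (innerSL ℝ v).hasFDerivAt
  have h0 := hmin.hasFDerivAt_eq_zero hf
  refine ext_inner_right ℝ fun w => ?_
  rw [inner_gradient_left]
  have := congrArg (fun L => L w) h0
  simp only [_root_.sub_apply, innerSL_apply_apply, _root_.zero_apply] at this
  linarith

section Caratheodory

variable {X : Type*} [MeasurableSpace X] {μ : Measure X}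

/-- Composition of a Carathéodory function with a measurable function. -/
theorem aemeasurable_comp_of_continuous {E : Type*} [PseudoEMetricSpace E] [Nonempty E]
    [SecondCountableTopology E] [MeasurableSpace E] [OpensMeasurableSpace E] {h : X → E → ℝ}
    (hm : ∀ p, AEMeasurable (fun z => h z p) μ) (hc : ∀ᵐ z ∂μ, Continuous (h z))
    {P : X → E} (hP : AEMeasurable P μ) : AEMeasurable (fun z => h z (P z)) μ := by
  set e := TopologicalSpace.denseSeq E
  set F : ℕ → X → ℝ := fun k => (hm (e k)).mk _
  have hF : ∀ᵐ z ∂μ, ∀ k, h z (e k) = F k z := ae_all_iff.2 fun k => (hm (e k)).ae_eq_mk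
  have hFm : Measurable fun y : X × ℕ => F y.2 y.1 :=
    measurable_from_prod_countable_left fun k => (hm (e k)).measurable_mk
  -- Replace `P z` by the nearest among the first points of a dense sequence. This takes countably
  -- many values, so the composition is measurable; continuity in `p` gives the limit.
  refine aemeasurable_of_tendsto_metrizable_ae' (f := fun n z =>
    F (SimpleFunc.nearestPtInd e n (hP.mk P z)) z) (fun n => ?_) ?_
  · exact (hFm.comp (measurable_id.prodMk
      ((SimpleFunc.nearestPtInd e n).measurable.comp hP.measurable_mk))).aemeasurable
  · filter_upwards [hF, hc, hP.ae_eq_mk] with z hz hcz hPz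
    have ht : Tendsto (fun n => SimpleFunc.nearestPt e n (P z)) atTop (𝓝 (P z)) :=
      SimpleFunc.tendsto_nearestPt (TopologicalSpace.denseRange_denseSeq E (P z))
    refine ((hcz.tendsto _).comp ht).congr fun n => ?_
    rw [← hPz, ← hz]
    rfl

/-- The gradient of a Carathéodory function along a measurable function is measurable. -/
theorem aemeasurable_gradient_comp {d : ℕ} {h : X → Space d → ℝ}
    (hm : ∀ p, AEMeasurable (fun z => h z p) μ) (hd : ∀ᵐ z ∂μ, Differentiable ℝ (h z))
    {P : X → Space d} (hP : AEMeasurable P μ) : AEMeasurable (fun z => ∇ (h z) (P z)) μ := by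
  have hc : ∀ᵐ z ∂μ, Continuous (h z) := hd.mono fun z hz => hz.continuous
  have hdir : ∀ e : Space d, AEMeasurable (fun z => inner ℝ e (∇ (h z) (P z))) μ := by
    intro e
    -- Each directional derivative is the limit of difference quotients with step `1/(n+1)`.
    refine aemeasurable_of_tendsto_metrizable_ae' (f := fun (n : ℕ) z =>
      (n + 1 : ℝ) * (h z (P z + ((n : ℝ) + 1)⁻¹ • e) - h z (P z))) (fun n => ?_) ?_
    · exact ((aemeasurable_comp_of_continuous hm hc (hP.add_const _)).sub
        (aemeasurable_comp_of_continuous hm hc hP)).const_mul _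
    · filter_upwards [hd] with z hz
      rw [real_inner_comm, inner_gradient_left]
      have hn : Tendsto (fun n : ℕ => ‖(n : ℝ) + 1‖) atTop atTop :=
        tendsto_norm_atTop_atTop.comp (tendsto_atTop_add_const_right _ _ tendsto_natCast_atTop_atTop)
      exact (hz (P z)).hasFDerivAt.lim e hn
  have hsum : (fun z => ∇ (h z) (P z)) = fun z => ∑ i,
      inner ℝ (EuclideanSpace.basisFun (Fin d) ℝ i) (∇ (h z) (P z)) •
        EuclideanSpace.basisFun (Fin d) ℝ i := by
    funext z
    exact ((EuclideanSpace.basisFun (Fin d) ℝ).sum_repr' _).symm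
  rw [hsum]
  exact Finset.aemeasurable_fun_sum _ fun i _ => (hdir _).smul_const _

/-- A set that is not null contains a measurable set of positive finite measure on which a given
measurable function is bounded. -/
theorem exists_measurableSet_subset_norm_le [SigmaFinite μ] {s : Set X} (hs : NullMeasurableSet s μ)
    (hs0 : μ s ≠ 0) {F : X → ℝ} (hF : AEMeasurable F μ) :
    ∃ A ⊆ s, MeasurableSet A ∧ μ A ≠ 0 ∧ μ A ≠ ⊤ ∧ ∃ C : ℝ, ∀ z ∈ A, |F z| ≤ C := by
  set F' := hF.mk F
  have hs' : (s ∩ {z | F z = F' z} : Set X) =ᵐ[μ] s := by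
    filter_upwards [hF.ae_eq_mk] with z hz
    exact propext ⟨fun h => h.1, fun h => ⟨h, hz⟩⟩
  obtain ⟨t, ht, htm, hts⟩ := (hs.congr hs'.symm).exists_measurable_subset_ae_eq
  have ht0 : μ t ≠ 0 := by rwa [measure_congr (hts.trans hs')]
  -- Exhaust `t` by pieces of finite measure with `|F'| ≤ n`; one of them is not null. On `t` the
  -- representative `F'` agrees with `F` at every point.
  set B : ℕ → Set X := fun n => t ∩ (spanningSets μ n ∩ {z | |F' z| ≤ n})
  have hU : t = ⋃ n, B n := by
    refine Subset.antisymm (fun z hz => ?_) (iUnion_subset fun n => inter_subset_left)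
    obtain ⟨n, hn⟩ := exists_nat_ge |F' z|
    refine mem_iUnion.2 ⟨max (spanningSetsIndex μ z) n, hz, ?_, ?_⟩
    · exact monotone_spanningSets μ (le_max_left _ _) (mem_spanningSetsIndex μ z)
    · exact hn.trans (by exact_mod_cast le_max_right _ _)
  have : ∃ n, μ (B n) ≠ 0 := by
    by_contra! hc
    exact ht0 (by rw [hU]; exact measure_iUnion_null hc)
  obtain ⟨n, hn⟩ := this
  refine ⟨B n, inter_subset_left.trans (ht.trans inter_subset_left), ?_, hn, ?_, n, ?_⟩
  · exact htm.inter ((measurableSet_spanningSets μ n).inter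
      (measurableSet_le hF.measurable_mk.abs measurable_const))
  · exact ((measure_mono (inter_subset_right.trans inter_subset_left)).trans_lt
      (measure_spanningSets_lt_top μ n)).ne
  · rintro z ⟨hz, -, hz2⟩
    rw [show F z = F' z from (ht hz).2]
    exact hz2

/-- A function that is bounded on a set of finite measure is square integrable there. -/
theorem memLp_indicator_of_norm_le {E : Type*} [NormedAddCommGroup E] {A : Set X}
    (hA : MeasurableSet A) (hAt : μ A ≠ ⊤) {f : X → E} (hf : AEStronglyMeasurable f μ) {C : ℝ}
    (hC : ∀ z ∈ A, ‖f z‖ ≤ C) : MemLp (A.indicator f) 2 μ := by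
  rw [memLp_indicator_iff_restrict hA]
  have : IsFiniteMeasure (μ.restrict A) := ⟨by simpa using hAt.lt_top⟩
  exact MemLp.of_bound hf.restrict C ((ae_restrict_iff' hA).2 (Eventually.of_forall hC))

end Caratheodory

namespace MFG

/-! ### The extended integral -/

section ExtIntegral

variable {X : Type*} [MeasurableSpace X] {μ : Measure X}

theorem extIntegral_congr_ae {f g : X → EReal} (h : f =ᵐ[μ] g) :
    extIntegral μ f = extIntegral μ g := by
  unfold extIntegral
  rw [lintegral_congr_ae (h.mono fun z hz => congrArg EReal.toENNReal hz),
    lintegral_congr_ae (h.mono fun z hz => congrArg (fun y : EReal => (-y).toENNReal) hz)]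

/-- Lower integrals are monotone without measurability, which allows comparison with the Lagrangian
directly. -/
theorem extIntegral_mono_ae {f g : X → EReal} (h : ∀ᵐ z ∂μ, f z ≤ g z) :
    extIntegral μ f ≤ extIntegral μ g := by
  refine EReal.sub_le_sub ?_ ?_
  · exact EReal.coe_ennreal_le_coe_ennreal_iff.2
      (lintegral_mono_ae (h.mono fun z hz => EReal.toENNReal_le_toENNReal hz))
  · exact EReal.coe_ennreal_le_coe_ennreal_iff.2
      (lintegral_mono_ae (h.mono fun z hz =>
        EReal.toENNReal_le_toENNReal (EReal.neg_le_neg_iff.2 hz)))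

theorem extIntegral_coe {f : X → ℝ} (hf : Integrable f μ) :
    extIntegral μ (fun z => (f z : EReal)) = ((∫ z, f z ∂μ : ℝ) : EReal) := by
  have h1 : ∫⁻ z, ENNReal.ofReal (f z) ∂μ ≠ ⊤ := hf.lintegral_lt_top.ne
  have h2 : ∫⁻ z, ENNReal.ofReal (-f z) ∂μ ≠ ⊤ := hf.neg.lintegral_lt_top.ne
  rw [integral_eq_lintegral_pos_part_sub_lintegral_neg_part hf, EReal.coe_sub]
  unfold extIntegral
  simp only [← EReal.coe_neg, EReal.real_coe_toENNReal]
  rw [← EReal.coe_ennreal_toReal h1, ← EReal.coe_ennreal_toReal h2]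

end ExtIntegral

/-! ### The Lagrangian -/

section Lagrangian

variable {d : ℕ} (H : ℝ → Space d → Space d → ℝ) {t : ℝ} {x : Space d}

theorem le_lagrangian (v p : Space d) :
    ((-(inner ℝ v p) - H t x p : ℝ) : EReal) ≤ lagrangian H t x v :=
  le_iSup (fun p : Space d => ((-(inner ℝ v p) - H t x p : ℝ) : EReal)) p

/-- For `v = -∇H(p)` the concave function under the supremum is stationary at `p`, so `p` is a
maximizer. This is the equality case of Fenchel's inequality. -/
theorem lagrangian_neg_gradient (hc : ConvexOn ℝ univ (H t x)) {p : Space d}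
    (hd : DifferentiableAt ℝ (H t x) p) :
    lagrangian H t x (-∇ (H t x) p) = ((inner ℝ (∇ (H t x) p) p - H t x p : ℝ) : EReal) := by
  refine le_antisymm (iSup_le fun p' => ?_) ?_
  · have := hc.add_inner_gradient_le hd p'
    rw [inner_sub_right] at this
    rw [EReal.coe_le_coe_iff, inner_neg_left]
    linarith
  · refine le_of_eq_of_le ?_ (le_lagrangian H (-∇ (H t x) p) p)
    rw [inner_neg_left, neg_neg]

theorem le_mul_lagrangian {ρ : ℝ} (hρ : 0 ≤ ρ) {m : Space d} (hm : ρ = 0 → m = 0) (p : Space d) :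
    ((-(inner ℝ m p) - ρ * H t x p : ℝ) : EReal) ≤ (ρ : EReal) * lagrangian H t x (ρ⁻¹ • m) := by
  rcases hρ.eq_or_lt with h | h
  -- At vacuum both sides are `0`, even if the Lagrangian is `⊤`, since `0 * ⊤ = 0`.
  · simp [← h, hm h.symm]
  · refine le_of_eq_of_le ?_ (mul_le_mul_of_nonneg_left (le_lagrangian H (ρ⁻¹ • m) p)
      (EReal.coe_nonneg.2 hρ))
    rw [← EReal.coe_mul, real_inner_smul_left]
    congr 1
    field_simp

theorem mul_lagrangian_neg_gradient (hc : ConvexOn ℝ univ (H t x)) {p : Space d}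
    (hd : DifferentiableAt ℝ (H t x) p) {ρ : ℝ} {m : Space d}
    (hm : m = -(ρ • ∇ (H t x) p)) :
    (ρ : EReal) * lagrangian H t x (ρ⁻¹ • m) = ((-(inner ℝ m p) - ρ * H t x p : ℝ) : EReal) := by
  rcases eq_or_ne ρ 0 with h | h
  · simp [h, hm]
  · have : ρ⁻¹ • m = -∇ (H t x) p := by rw [hm, smul_neg, smul_smul, inv_mul_cancel₀ h, one_smul]
    rw [this, lagrangian_neg_gradient H hc hd, ← EReal.coe_mul, hm, inner_neg_left,
      real_inner_smul_left]
    congr 1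
    ring

end Lagrangian

end MFG

namespace MFG

variable {d : ℕ} {Ω : Set (Space d)}

/-! ### The pairing -/

theorem L2Q.inner_eq (f g : L2Q Ω) : inner ℝ f g = ∫ z, f z * g z ∂(cylMeasure Ω) := by
  rw [L2.inner_def]
  exact integral_congr_ae (Eventually.of_forall fun z => mul_comm _ _)

theorem L2X.inner_eq (f g : L2X Ω) : inner ℝ f g = ∫ x, f x * g x ∂(spaceMeasure Ω) := by
  rw [L2.inner_def]
  exact integral_congr_ae (Eventually.of_forall fun z => mul_comm _ _)

theorem integrable_mul_add_inner (f ρ : L2Q Ω) (g m : L2QV Ω) :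
    Integrable (fun z => f z * ρ z + inner ℝ (g z) (m z)) (cylMeasure Ω) :=
  (MemLp.integrable_mul (p := 2) (q := 2) (Lp.memLp f) (Lp.memLp ρ)).add (L2.integrable_inner g m)

theorem integral_mul_add_inner (f ρ : L2Q Ω) (g m : L2QV Ω) :
    ∫ z, (f z * ρ z + inner ℝ (g z) (m z)) ∂(cylMeasure Ω) = inner ℝ f ρ + inner ℝ g m := by
  rw [integral_add, L2Q.inner_eq, L2.inner_def]
  · exact MemLp.integrable_mul (p := 2) (q := 2) (Lp.memLp f) (Lp.memLp ρ)
  · exact L2.integrable_inner g m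

theorem pairing_eq_inner (q u : State Ω) :
    pairing q u = inner ℝ q.rho u.rho + inner ℝ q.flux u.flux + inner ℝ q.rhoInit u.rhoInit
      + inner ℝ q.rhoTerm u.rhoTerm := by
  rw [pairing, integral_mul_add_inner, L2X.inner_eq, L2X.inner_eq]

theorem pairing_comm (q u : State Ω) : pairing q u = pairing u q := by
  simp only [pairing_eq_inner, real_inner_comm]

theorem pairing_sub_right (q u w : State Ω) : pairing q (u - w) = pairing q u - pairing q w := by
  simp only [pairing_eq_inner, State.rho, State.flux, State.rhoInit, State.rhoTerm, Prod.fst_sub,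
    Prod.snd_sub, inner_sub_right]
  ring

/-! ### Bounds for the action -/

/-- The Hamiltonian is convex and differentiable for almost every `(x,t)`. -/
def IsConvexDifferentiable (Ω : Set (Space d)) (H : ℝ → Space d → Space d → ℝ) : Prop :=
  ∀ᵐ z ∂(cylMeasure Ω), ConvexOn ℝ univ (H z.2 z.1) ∧ Differentiable ℝ (H z.2 z.1)

theorem isConvexDifferentiable_of_forall (hΩ : IsOpen Ω) {H : ℝ → Space d → Space d → ℝ}
    (hHconv : ∀ t ∈ Ioo (0 : ℝ) 1, ∀ x ∈ Ω, ConvexOn ℝ univ (H t x))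
    (hHdiff : ∀ t ∈ Ioo (0 : ℝ) 1, ∀ x ∈ Ω, Differentiable ℝ (H t x)) :
    IsConvexDifferentiable Ω H := by
  have hx : ∀ᵐ z ∂(cylMeasure Ω), z.1 ∈ Ω :=
    Measure.quasiMeasurePreserving_fst (μ := spaceMeasure Ω) (ν := timeMeasure)
      |>.ae (ae_restrict_mem hΩ.measurableSet)
  filter_upwards [hx, ae_mem_Ioo (Ω := Ω)] with z hz ht
  exact ⟨hHconv _ ht _ hz, hHdiff _ ht _ hz⟩

variable {H : ℝ → Space d → Space d → ℝ} {ρ₀ : L2X Ω}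

/-- The dual constraint `ρ̂ + H(t,x,-m̂) ≤ 0` a.e. -/
def SatisfiesHJ (H : ℝ → Space d → Space d → ℝ) (q : State Ω) : Prop :=
  ∀ᵐ z ∂(cylMeasure Ω), q.rho z + H z.2 z.1 (-q.flux z) ≤ 0

/-- A state at which the action is not `+∞` by definition. -/
def IsAdmissible (ρ₀ : L2X Ω) (u : State Ω) : Prop :=
  u.rhoInit = ρ₀ ∧ (∀ᵐ z ∂(cylMeasure Ω), 0 ≤ u.rho z) ∧
    (∀ᵐ z ∂(cylMeasure Ω), u.rho z = 0 → u.flux z = 0)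

theorem action_of_isAdmissible {u : State Ω} (hu : IsAdmissible ρ₀ u) :
    action H ρ₀ u = extIntegral (cylMeasure Ω)
      (fun z => (u.rho z : EReal) * lagrangian H z.2 z.1 ((u.rho z)⁻¹ • u.flux z)) :=
  if_pos hu

theorem action_of_not_isAdmissible {u : State Ω} (hu : ¬IsAdmissible ρ₀ u) :
    action H ρ₀ u = ⊤ :=
  if_neg hu

/-- Fenchel's inequality at `p = -m̂` gives the integrand bound `m̂·m - ρ H(-m̂)`, and `ρ ≥ 0` with
the dual constraint lets `ρ̂` replace `-H(-m̂)`. -/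
theorem le_action {q : State Ω} (hq : SatisfiesHJ H q) (w : State Ω) :
    ((inner ℝ q.rho w.rho + inner ℝ q.flux w.flux : ℝ) : EReal) ≤ action H ρ₀ w := by
  by_cases hw : IsAdmissible ρ₀ w
  · rw [action_of_isAdmissible hw, ← integral_mul_add_inner,
      ← extIntegral_coe (integrable_mul_add_inner _ _ _ _)]
    refine extIntegral_mono_ae ?_
    filter_upwards [hq, hw.2.1, hw.2.2] with z hz h1 h2
    refine le_trans ?_ (le_mul_lagrangian H h1 h2 (-q.flux z))
    rw [EReal.coe_le_coe_iff, inner_neg_right, real_inner_comm (q.flux z)]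
    nlinarith
  · rw [action_of_not_isAdmissible hw]
    exact le_top

/-- The flux `-ρ ∇H(P)` realizes equality in Fenchel's inequality pointwise, so on such states the
action is an ordinary integral of data of `H` along `P`. -/
theorem action_eq_integral (hH : IsConvexDifferentiable Ω H) {u : State Ω} (hu0 : u.rhoInit = ρ₀)
    (hρ : ∀ᵐ z ∂(cylMeasure Ω), 0 ≤ u.rho z) {P : Space d × ℝ → Space d}
    (hm : ∀ᵐ z ∂(cylMeasure Ω), u.flux z = -(u.rho z • ∇ (H z.2 z.1) (P z)))
    {g : Space d × ℝ → ℝ} (hg : Integrable g (cylMeasure Ω))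
    (hgP : ∀ᵐ z ∂(cylMeasure Ω), g z = -(inner ℝ (u.flux z) (P z)) - u.rho z * H z.2 z.1 (P z)) :
    action H ρ₀ u = ((∫ z, g z ∂(cylMeasure Ω) : ℝ) : EReal) := by
  have hu : IsAdmissible ρ₀ u := by
    refine ⟨hu0, hρ, ?_⟩
    filter_upwards [hm] with z hz h0
    rw [hz, h0, zero_smul, neg_zero]
  rw [action_of_isAdmissible hu, ← extIntegral_coe hg]
  refine extIntegral_congr_ae ?_
  filter_upwards [hH, hm, hgP] with z hz h1 h2
  rw [h2]
  exact mul_lagrangian_neg_gradient H hz.1 (hz.2 _) h1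

/-- The vacuum state shows that the action is proper. The terminal value is unconstrained, which
later forces `ρ̂(·,1) = 0`. -/
theorem action_zero_density (hH : IsConvexDifferentiable Ω H) (σ : L2X Ω) :
    action H ρ₀ (0, 0, ρ₀, σ) = 0 := by
  have h0 := Lp.coeFn_zero ℝ 2 (cylMeasure Ω)
  have h0' := Lp.coeFn_zero (Space d) 2 (cylMeasure Ω)
  rw [action_eq_integral hH (u := (0, 0, ρ₀, σ)) (g := 0) (P := 0) rfl, Pi.zero_def, integral_zero, EReal.coe_zero]
  · filter_upwards [h0] with z hz
    rw [State.rho, hz]; rfl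
  · filter_upwards [h0, h0'] with z hz hz'
    rw [State.rho, State.flux, hz, hz']; simp
  · exact integrable_zero _ _ _
  · filter_upwards [h0] with z hz
    rw [State.rho, hz]; simp

theorem action_ne_bot
    (hHfin : ∃ p : L2QV Ω, MemLp (fun z => H z.2 z.1 (p z)) 2 (cylMeasure Ω)) (w : State Ω) :
    action H ρ₀ w ≠ ⊥ := by
  obtain ⟨p, hp⟩ := hHfin
  -- The dual point `(-H(p), -p, 0, 0)` satisfies the constraint with equality and lies in `L²`, so
  -- it supplies a finite lower bound.
  have h : SatisfiesHJ H ((-hp.toLp _, -p, 0, 0) : State Ω) := by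
    filter_upwards [Lp.coeFn_neg (hp.toLp _), hp.coeFn_toLp, Lp.coeFn_neg p] with z h1 h2 h3
    rw [State.rho, State.flux, h1, h3, Pi.neg_apply, Pi.neg_apply, h2, neg_neg, neg_add_cancel]
  exact ne_bot_of_le_ne_bot (EReal.coe_ne_bot _) (le_action h w)

/-! ### The conjugate of the action -/

theorem conjugate_action_le {q : State Ω} (hq : SatisfiesHJ H q) (hq1 : q.rhoTerm = 0) :
    conjugate (action H ρ₀) q ≤ ((inner ℝ q.rhoInit ρ₀ : ℝ) : EReal) := by
  refine iSup_le fun w => ?_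
  by_cases hw : IsAdmissible ρ₀ w
  · refine EReal.sub_le_of_le_add ?_
    refine le_trans ?_ (add_le_add_right (le_action (ρ₀ := ρ₀) hq w) _)
    rw [← EReal.coe_add, EReal.coe_le_coe_iff, pairing_eq_inner, hq1, hw.1, inner_zero_left]
    linarith
  · rw [action_of_not_isAdmissible hw, EReal.sub_top]
    exact bot_le

theorem le_conjugate_action (hH : IsConvexDifferentiable Ω H) (q : State Ω) (σ : L2X Ω) :
    ((inner ℝ q.rhoInit ρ₀ + inner ℝ q.rhoTerm σ : ℝ) : EReal) ≤ conjugate (action H ρ₀) q := by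
  refine le_of_eq_of_le ?_ (le_iSup _ ((0, 0, ρ₀, σ) : State Ω))
  rw [action_zero_density hH, pairing_eq_inner, sub_zero, inner_zero_right, inner_zero_right]
  simp only [zero_add]

/-! ### Constraints forced by finiteness of the conjugate -/

theorem exists_real_le_of_ne_top {f : State Ω → EReal} {q : State Ω} (h : conjugate f q ≠ ⊤) :
    ∃ M : ℝ, conjugate f q ≤ M :=
  ⟨_, EReal.le_coe_toReal h⟩

theorem eq_zero_of_forall_mul_le {c k M : ℝ} (hc : 0 ≤ c) (h : ∀ n : ℕ, k + n * c ≤ M) : c = 0 := by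
  by_contra h0
  have hpos : 0 < c := lt_of_le_of_ne hc (Ne.symm h0)
  obtain ⟨n, hn⟩ := exists_nat_gt ((M - k) / c)
  have := h n
  rw [div_lt_iff₀ hpos] at hn
  linarith

/-- Vacuum states with terminal value `n ρ̂(·,1)` have zero action, while their pairing with `q`
grows like `n ‖ρ̂(·,1)‖²`. -/
theorem rhoTerm_eq_zero_of_conjugate_ne_top (hH : IsConvexDifferentiable Ω H) {q : State Ω}
    (hq : conjugate (action H ρ₀) q ≠ ⊤) : q.rhoTerm = 0 := by
  obtain ⟨M, hM⟩ := exists_real_le_of_ne_top hq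
  refine inner_self_eq_zero (𝕜 := ℝ).1 (eq_zero_of_forall_mul_le (k := inner ℝ q.rhoInit ρ₀)
    (M := M) real_inner_self_nonneg fun n => ?_)
  have := (le_conjugate_action (ρ₀ := ρ₀) hH q ((n : ℝ) • q.rhoTerm)).trans hM
  rwa [EReal.coe_le_coe_iff, real_inner_smul_right] at this

/-- If the constraint fails on a set `A` of positive measure, put density `n` on `A` and let it move
with velocity `-∇H(-m̂)`. The action is then explicit and `⟨q,u⟩ - Ξ(u)` grows like `n ∫_A (ρ̂ +
H(-m̂))`. -/
theorem satisfiesHJ_of_conjugate_ne_top (hH : IsConvexDifferentiable Ω H)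
    (hHmeas : ∀ p, AEMeasurable (fun z : Space d × ℝ => H z.2 z.1 p) (cylMeasure Ω))
    {q : State Ω} (hq : conjugate (action H ρ₀) q ≠ ⊤) : SatisfiesHJ H q := by
  obtain ⟨M, hM⟩ := exists_real_le_of_ne_top hq
  have hPm : AEMeasurable (fun z => -q.flux z) (cylMeasure Ω) :=
    (Lp.aestronglyMeasurable q.flux).aemeasurable.neg
  have hqm : AEMeasurable (fun z => q.rho z) (cylMeasure Ω) :=
    (Lp.aestronglyMeasurable q.rho).aemeasurable
  have hhm : AEMeasurable (fun z => H z.2 z.1 (-q.flux z)) (cylMeasure Ω) :=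
    aemeasurable_comp_of_continuous hHmeas (hH.mono fun z hz => hz.2.continuous) hPm
  have hgm : AEMeasurable (fun z => ∇ (H z.2 z.1) (-q.flux z)) (cylMeasure Ω) :=
    aemeasurable_gradient_comp hHmeas (hH.mono fun z hz => hz.2) hPm
  by_contra hcon
  have hs0 : cylMeasure Ω {z | 0 < q.rho z + H z.2 z.1 (-q.flux z)} ≠ 0 := fun h => hcon <| by
    rw [measure_eq_zero_iff_ae_notMem] at h
    exact h.mono fun z hz => not_lt.1 hz
  have hsn : NullMeasurableSet {z | 0 < q.rho z + H z.2 z.1 (-q.flux z)} (cylMeasure Ω) :=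
    nullMeasurableSet_lt aemeasurable_const (hqm.add hhm)
  -- Bounding the sum `‖∇H‖ + |H|` bounds both terms at once; boundedness and finite measure put the
  -- test state in `L²`.
  obtain ⟨A, hAs, hA, hA0, hAt, C, hC⟩ := exists_measurableSet_subset_norm_le hsn hs0
    (hgm.norm.add hhm.abs)
  have hbound : ∀ z ∈ A, ‖∇ (H z.2 z.1) (-q.flux z)‖ ≤ C ∧ |H z.2 z.1 (-q.flux z)| ≤ C := by
    intro z hz
    have h1 := (le_abs_self _).trans (hC z hz)
    simp only [Pi.add_apply] at h1
    constructor
    · linarith [abs_nonneg (H z.2 z.1 (-q.flux z))]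
    · linarith [norm_nonneg (∇ (H z.2 z.1) (-q.flux z))]
  have hone : MemLp (A.indicator fun _ => (1 : ℝ)) 2 (cylMeasure Ω) :=
    memLp_indicator_of_norm_le hA hAt aestronglyMeasurable_const (C := 1) fun z _ => by simp
  have hgrad : MemLp (A.indicator fun z => ∇ (H z.2 z.1) (-q.flux z)) 2 (cylMeasure Ω) :=
    memLp_indicator_of_norm_le hA hAt hgm.aestronglyMeasurable fun z hz => (hbound z hz).1
  have hham : MemLp (A.indicator fun z => H z.2 z.1 (-q.flux z)) 2 (cylMeasure Ω) :=
    memLp_indicator_of_norm_le hA hAt hhm.aestronglyMeasurable fun z hz => (hbound z hz).2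
  have hham1 : Integrable (A.indicator fun z => H z.2 z.1 (-q.flux z)) (cylMeasure Ω) := by
    refine (MemLp.integrable_mul (p := 2) (q := 2) hham hone).congr
      (Eventually.of_forall fun z => ?_)
    by_cases hz : z ∈ A <;> simp [hz]
  set ρ : L2Q Ω := hone.toLp _
  set m : L2QV Ω := -hgrad.toLp _
  have hρ : ∀ᵐ z ∂(cylMeasure Ω), ρ z = A.indicator (fun _ => (1 : ℝ)) z := hone.coeFn_toLp
  have hm : ∀ᵐ z ∂(cylMeasure Ω),
      m z = -A.indicator (fun z => ∇ (H z.2 z.1) (-q.flux z)) z := by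
    filter_upwards [Lp.coeFn_neg (hgrad.toLp _), hgrad.coeFn_toLp] with z h1 h2
    rw [h1, Pi.neg_apply, h2]
  set c := (inner ℝ q.rho ρ + ∫ z, A.indicator (fun z => H z.2 z.1 (-q.flux z)) z ∂(cylMeasure Ω))
    with hcdef
  have hqi : Integrable (fun z => q.rho z * ρ z) (cylMeasure Ω) :=
    MemLp.integrable_mul (p := 2) (q := 2) (Lp.memLp _) (Lp.memLp _)
  have hcint : c = ∫ z, A.indicator (fun z => q.rho z + H z.2 z.1 (-q.flux z)) z
      ∂(cylMeasure Ω) := by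
    rw [hcdef, L2Q.inner_eq, ← integral_add hqi hham1]
    refine integral_congr_ae ?_
    filter_upwards [hρ] with z hz
    rw [hz]
    by_cases hzA : z ∈ A <;> simp [hzA]
  have hcI : Integrable (A.indicator (fun z => q.rho z + H z.2 z.1 (-q.flux z)))
      (cylMeasure Ω) := by
    refine (hqi.add hham1).congr ?_
    filter_upwards [hρ] with z hz
    rw [Pi.add_apply, hz]
    by_cases hzA : z ∈ A <;> simp [hzA]
  have hnn : 0 ≤ A.indicator (fun z => q.rho z + H z.2 z.1 (-q.flux z)) :=
    fun z => indicator_nonneg (fun z hz => le_of_lt (hAs hz)) z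
  have hc0 : c = 0 := by
    refine eq_zero_of_forall_mul_le (k := inner ℝ q.rhoInit ρ₀) (M := M)
      (by rw [hcint]; exact integral_nonneg hnn) fun n => ?_
    set u : State Ω := ((n : ℝ) • ρ, (n : ℝ) • m, ρ₀, 0) with hu
    have huρ : ∀ᵐ z ∂(cylMeasure Ω), u.rho z = n * ρ z := Lp.coeFn_smul (n : ℝ) ρ
    have hum : ∀ᵐ z ∂(cylMeasure Ω), u.flux z = (n : ℝ) • m z := Lp.coeFn_smul (n : ℝ) m
    have hact : action H ρ₀ u = ((∫ z, (n : ℝ) * (inner ℝ (q.flux z) (m z)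
        - A.indicator (fun z => H z.2 z.1 (-q.flux z)) z) ∂(cylMeasure Ω) : ℝ) : EReal) := by
      refine action_eq_integral hH rfl (P := fun z => -q.flux z) ?_ ?_
        (((L2.integrable_inner q.flux m).sub hham1).const_mul _) ?_
      · filter_upwards [huρ, hρ] with z h1 h2
        rw [h1, h2]
        exact mul_nonneg n.cast_nonneg (indicator_nonneg (fun _ _ => zero_le_one) z)
      · filter_upwards [huρ, hum, hρ, hm] with z h1 h2 h3 h4
        rw [h1, h2, h3, h4]
        by_cases hzA : z ∈ A <;> simp [hzA]
      · filter_upwards [huρ, hum, hρ] with z h1 h2 h3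
        rw [h1, h2, h3, inner_neg_right, neg_neg, real_inner_smul_left, real_inner_comm]
        by_cases hzA : z ∈ A <;> simp [hzA]
        ring
    have h := (le_iSup (fun u : State Ω => ((pairing q u : ℝ) : EReal) - action H ρ₀ u) u).trans hM
    rw [hact, integral_const_mul, integral_sub (L2.integrable_inner q.flux m) hham1,
      ← L2.inner_def, ← EReal.coe_sub, EReal.coe_le_coe_iff, pairing_eq_inner, hu] at h
    simp only [State.rho, State.flux, State.rhoInit, State.rhoTerm, real_inner_smul_right,
      inner_zero_right] at h
    rw [hcdef]
    linarith
  rw [hcint, integral_eq_zero_iff_of_nonneg hnn hcI] at hc0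
  refine hA0 ?_
  rw [measure_eq_zero_iff_ae_notMem]
  filter_upwards [hc0] with z hz hzA
  rw [indicator_of_mem hzA] at hz
  exact (hAs hzA).ne' hz

end MFG

namespace MFG

variable {d : ℕ} {Ω : Set (Space d)}
variable {H : ℝ → Space d → Space d → ℝ} {ρ₀ : L2X Ω}

/-! ### Optimality conditions for a dual pair -/

/-- The pointwise optimality conditions for a pair `(q, u)`. -/
structure IsOptimalPair (H : ℝ → Space d → Space d → ℝ) (ρ₀ : L2X Ω) (q u : State Ω) : Prop where
  rho_nonneg : ∀ᵐ z ∂(cylMeasure Ω), 0 ≤ u.rho z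
  satisfiesHJ : SatisfiesHJ H q
  complementarity : ∀ᵐ z ∂(cylMeasure Ω), 0 < u.rho z → q.rho z + H z.2 z.1 (-q.flux z) = 0
  flux_eq : ∀ᵐ z ∂(cylMeasure Ω), u.flux z = -(u.rho z • ∇ (H z.2 z.1) (-q.flux z))
  rhoInit_eq : u.rhoInit = ρ₀
  rhoTerm_eq : q.rhoTerm = 0

/-- The subgradient inequality for `Ξ*`, with `Ξ*(q)` bounded below and `Ξ*(p)` above by their
explicit values: a statement about real numbers for every feasible competitor `p`. -/
theorem pairing_sub_le_of_mem_subdiff_conjugate (hH : IsConvexDifferentiable Ω H) {q u : State Ω}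
    (h : u ∈ subdiff (conjugate (action H ρ₀)) q) {p : State Ω} (hp : SatisfiesHJ H p)
    (hp1 : p.rhoTerm = 0) :
    inner ℝ q.rhoInit ρ₀ + pairing u (p - q) ≤ inner ℝ p.rhoInit ρ₀ := by
  have h1 := le_conjugate_action (ρ₀ := ρ₀) hH q 0
  rw [inner_zero_right, add_zero] at h1
  have h2 := ((add_le_add_left h1 _).trans (h.2.2 p)).trans (conjugate_action_le hp hp1)
  rwa [← EReal.coe_add, EReal.coe_le_coe_iff] at h2

/-- Shift `m̂` by `w` on a set `A` and lower `ρ̂` there until the constraint holds with slack `c`.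
Such a `p` is feasible and has the same boundary components, so the first-order change `∫_A G` is at
most `0`; choosing `A` inside `{G > 0}` makes this a pointwise statement. The choices of `w` and `c`
yield all interior optimality conditions. -/
theorem inner_flux_le_of_mem_subdiff_conjugate (hH : IsConvexDifferentiable Ω H)
    (hHmeas : ∀ p, AEMeasurable (fun z : Space d × ℝ => H z.2 z.1 p) (cylMeasure Ω))
    {q u : State Ω} (h : u ∈ subdiff (conjugate (action H ρ₀)) q) (w : Space d) {c : ℝ}
    (hc : 0 ≤ c) :
    ∀ᵐ z ∂(cylMeasure Ω),
      inner ℝ w (u.flux z) ≤ u.rho z * (q.rho z + H z.2 z.1 (-(q.flux z + w)) + c) := by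
  have hq1 : q.rhoTerm = 0 := rhoTerm_eq_zero_of_conjugate_ne_top hH h.1
  have hq : SatisfiesHJ H q := satisfiesHJ_of_conjugate_ne_top hH hHmeas h.1
  set F : Space d × ℝ → ℝ := fun z => -(q.rho z + H z.2 z.1 (-(q.flux z + w)) + c)
  set G : Space d × ℝ → ℝ := fun z => F z * u.rho z + inner ℝ w (u.flux z)
  have hFm : AEMeasurable F (cylMeasure Ω) :=
    (((Lp.aestronglyMeasurable q.rho).aemeasurable.add
      (aemeasurable_comp_of_continuous hHmeas (hH.mono fun z hz => hz.2.continuous)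
        ((Lp.aestronglyMeasurable q.flux).aemeasurable.add_const w).neg)).add_const c).neg
  have hGm : AEMeasurable G (cylMeasure Ω) :=
    (hFm.mul (Lp.aestronglyMeasurable u.rho).aemeasurable).add
      (aemeasurable_const.inner (Lp.aestronglyMeasurable u.flux).aemeasurable)
  suffices hG : ∀ᵐ z ∂(cylMeasure Ω), G z ≤ 0 by
    filter_upwards [hG] with z hz
    simp only [G, F] at hz
    linarith
  by_contra hcon
  have hs0 : cylMeasure Ω {z | 0 < G z} ≠ 0 := fun h => hcon <| by
    rw [measure_eq_zero_iff_ae_notMem] at h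
    exact h.mono fun z hz => not_lt.1 hz
  obtain ⟨A, hAs, hA, hA0, hAt, C, hC⟩ := exists_measurableSet_subset_norm_le
    (nullMeasurableSet_lt aemeasurable_const hGm) hs0 hFm
  have hFA : MemLp (A.indicator F) 2 (cylMeasure Ω) :=
    memLp_indicator_of_norm_le hA hAt hFm.aestronglyMeasurable hC
  have hwA : MemLp (A.indicator fun _ => w) 2 (cylMeasure Ω) :=
    memLp_indicator_of_norm_le hA hAt aestronglyMeasurable_const (C := ‖w‖) fun z _ => le_rfl
  set p : State Ω := (q.rho + hFA.toLp _, q.flux + hwA.toLp _, q.rhoInit, q.rhoTerm) with hp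
  have hpHJ : SatisfiesHJ H p := by
    filter_upwards [Lp.coeFn_add q.rho (hFA.toLp _), Lp.coeFn_add q.flux (hwA.toLp _),
      hFA.coeFn_toLp, hwA.coeFn_toLp, hq] with z h1 h2 h3 h4 h5
    rw [hp, State.rho, State.flux, h1, h2, Pi.add_apply, Pi.add_apply, h3, h4]
    by_cases hz : z ∈ A
    · rw [indicator_of_mem hz, indicator_of_mem hz]
      simp only [F]
      linarith
    · rw [indicator_of_notMem hz, indicator_of_notMem hz, add_zero, add_zero]
      exact h5
  have hle := pairing_sub_le_of_mem_subdiff_conjugate hH h hpHJ hq1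
  rw [pairing_sub_right, pairing_comm u, pairing_comm u, pairing_eq_inner, pairing_eq_inner, hp]
    at hle
  simp only [State.rho, State.flux, State.rhoInit, State.rhoTerm, inner_add_left] at hle
  have hint : ∫ z, A.indicator G z ∂(cylMeasure Ω) ≤ 0 := by
    have : ∫ z, A.indicator G z ∂(cylMeasure Ω)
        = inner ℝ (hFA.toLp _) u.rho + inner ℝ (hwA.toLp _) u.flux := by
      rw [← integral_mul_add_inner]
      refine integral_congr_ae ?_
      filter_upwards [hFA.coeFn_toLp, hwA.coeFn_toLp] with z h1 h2
      rw [h1, h2]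
      by_cases hz : z ∈ A <;> simp [hz, G]
    rw [this]
    linarith
  have hGI : Integrable (A.indicator G) (cylMeasure Ω) := by
    refine (integrable_mul_add_inner (hFA.toLp _) u.rho (hwA.toLp _) u.flux).congr ?_
    filter_upwards [hFA.coeFn_toLp, hwA.coeFn_toLp] with z h1 h2
    rw [h1, h2]
    by_cases hz : z ∈ A <;> simp [hz, G]
  have hnn : 0 ≤ A.indicator G := fun z => indicator_nonneg (fun z hz => le_of_lt (hAs hz)) z
  have h0 := (integral_eq_zero_iff_of_nonneg hnn hGI).1 (le_antisymm hint (integral_nonneg hnn))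
  refine hA0 ?_
  rw [measure_eq_zero_iff_ae_notMem]
  filter_upwards [h0] with z hz hzA
  rw [indicator_of_mem hzA] at hz
  exact (hAs hzA).ne' hz

theorem isOptimalPair_of_mem_subdiff_conjugate (hH : IsConvexDifferentiable Ω H)
    (hHmeas : ∀ p, AEMeasurable (fun z : Space d × ℝ => H z.2 z.1 p) (cylMeasure Ω))
    {q u : State Ω} (h : u ∈ subdiff (conjugate (action H ρ₀)) q) : IsOptimalPair H ρ₀ q u := by
  have hq1 : q.rhoTerm = 0 := rhoTerm_eq_zero_of_conjugate_ne_top hH h.1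
  have hq : SatisfiesHJ H q := satisfiesHJ_of_conjugate_ne_top hH hHmeas h.1
  have key : ∀ᵐ z ∂(cylMeasure Ω), ∀ (w : Space d) (n : ℕ),
      inner ℝ w (u.flux z) ≤ u.rho z * (q.rho z + H z.2 z.1 (-(q.flux z + w)) + n) := by
    -- Both sides are continuous in `w`, so a countable dense set of directions gives one null set
    -- valid for all `w`.
    have hdense : ∀ᵐ z ∂(cylMeasure Ω), ∀ k n : ℕ,
        inner ℝ (TopologicalSpace.denseSeq (Space d) k) (u.flux z) ≤ u.rho z * (q.rho z +
          H z.2 z.1 (-(q.flux z + TopologicalSpace.denseSeq (Space d) k)) + n) :=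
      ae_all_iff.2 fun k => ae_all_iff.2 fun n =>
        inner_flux_le_of_mem_subdiff_conjugate hH hHmeas h _ n.cast_nonneg
    filter_upwards [hdense, hH] with z hz hHz w n
    have hcont := hHz.2.continuous
    refine (TopologicalSpace.denseRange_denseSeq (Space d)).induction_on
      (p := fun w => inner ℝ w (u.flux z)
        ≤ u.rho z * (q.rho z + H z.2 z.1 (-(q.flux z + w)) + n)) w ?_ fun k => hz k n
    exact isClosed_le (by fun_prop) (by fun_prop)
  have hρ : ∀ᵐ z ∂(cylMeasure Ω), 0 ≤ u.rho z := by
    filter_upwards [key] with z hz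
    by_contra! hneg
    -- With `w = 0`, a negative density would violate the inequality for large slack `n`.
    obtain ⟨n, hn⟩ := exists_nat_gt (-(q.rho z + H z.2 z.1 (-(q.flux z + 0))))
    have := hz 0 n
    rw [inner_zero_left] at this
    nlinarith
  have hcomp : ∀ᵐ z ∂(cylMeasure Ω), 0 < u.rho z →
      q.rho z + H z.2 z.1 (-q.flux z) = 0 := by
    filter_upwards [key, hq] with z hz hqz hpos
    have := hz 0 0
    rw [inner_zero_left, add_zero, Nat.cast_zero, add_zero] at this
    exact le_antisymm hqz (nonneg_of_mul_nonneg_right this hpos)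
  refine ⟨hρ, hq, hcomp, ?_, ?_, hq1⟩
  · filter_upwards [key, hρ, hcomp, hH] with z hz hρz hcz hHz
    rcases hρz.eq_or_lt with h0 | hpos
    -- At vacuum the direction `w = m` gives `|m|² ≤ 0`.
    · have := hz (u.flux z) 0
      rw [← h0, zero_mul] at this
      rw [← h0, zero_smul, neg_zero]
      exact inner_self_eq_zero (𝕜 := ℝ).1 (le_antisymm this real_inner_self_nonneg)
    · have hv : -((u.rho z)⁻¹ • u.flux z) = ∇ (H z.2 z.1) (-q.flux z) := by
        refine eq_gradient_of_inner_le (hHz.2 _) fun y => ?_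
        -- This `w` moves the argument of `H` to `y`; by complementarity the inequality says that
        -- `-m/ρ` is a subgradient of `H` at `-m̂`.
        have h1 := hz (-q.flux z - y) 0
        rw [show -(q.flux z + (-q.flux z - y)) = y by abel, Nat.cast_zero, add_zero,
          show q.rho z = -H z.2 z.1 (-q.flux z) by linarith [hcz hpos], ← div_le_iff₀' hpos] at h1
        have h2 : inner ℝ (-((u.rho z)⁻¹ • u.flux z)) (y - -q.flux z)
            = inner ℝ (-q.flux z - y) (u.flux z) / u.rho z := by
          rw [inner_neg_left, ← inner_neg_right, neg_sub, real_inner_smul_left, real_inner_comm]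
          ring
        rw [h2]
        linarith
      rw [← hv, smul_neg, neg_neg, smul_smul, mul_inv_cancel₀ hpos.ne', one_smul]
  -- The constraint does not involve `ρ̂(·,0)`, so it may be shifted by `ρ(·,0) - ρ₀`; the result is
  -- `‖ρ(·,0) - ρ₀‖² ≤ 0`.
  · set p : State Ω := (q.rho, q.flux, q.rhoInit + (u.rhoInit - ρ₀), q.rhoTerm) with hp
    have hle := pairing_sub_le_of_mem_subdiff_conjugate hH h (p := p) hq hq1
    rw [pairing_sub_right, pairing_comm u, pairing_comm u, pairing_eq_inner, pairing_eq_inner, hp]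
      at hle
    simp only [State.rho, State.flux, State.rhoInit, State.rhoTerm, inner_add_left] at hle
    have h2 : inner ℝ (u.rhoInit - ρ₀) (u.rhoInit - ρ₀) ≤ 0 := by
      rw [inner_sub_right]
      simp only [State.rhoInit]
      linarith
    exact sub_eq_zero.1 (inner_self_eq_zero (𝕜 := ℝ).1 (le_antisymm h2 real_inner_self_nonneg))

/-- The bound `le_action` is attained: the flux relation gives equality in Fenchel's inequality, and
the dual constraint is tight wherever `ρ > 0`. -/
theorem IsOptimalPair.action_eq (hH : IsConvexDifferentiable Ω H) {q u : State Ω}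
    (h : IsOptimalPair H ρ₀ q u) :
    action H ρ₀ u = ((inner ℝ q.rho u.rho + inner ℝ q.flux u.flux : ℝ) : EReal) := by
  rw [← integral_mul_add_inner]
  refine action_eq_integral hH h.rhoInit_eq h.rho_nonneg h.flux_eq
    (integrable_mul_add_inner _ _ _ _) ?_
  filter_upwards [h.rho_nonneg, h.complementarity] with z h1 h2
  rw [inner_neg_right, neg_neg, real_inner_comm]
  rcases h1.eq_or_lt with h0 | hpos
  · rw [← h0]; ring
  · have := h2 hpos
    rw [show q.rho z = -H z.2 z.1 (-q.flux z) by linarith]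
    ring

theorem IsOptimalPair.mem_subdiff (hH : IsConvexDifferentiable Ω H) {q u : State Ω}
    (h : IsOptimalPair H ρ₀ q u) : q ∈ subdiff (action H ρ₀) u := by
  have hu := h.action_eq hH
  refine ⟨by rw [hu]; exact EReal.coe_ne_top _, by rw [hu]; exact EReal.coe_ne_bot _, fun w => ?_⟩
  by_cases hw : IsAdmissible ρ₀ w
  · refine le_trans ?_ (le_action h.satisfiesHJ w)
    rw [hu, ← EReal.coe_add, EReal.coe_le_coe_iff, pairing_sub_right, pairing_eq_inner,
      pairing_eq_inner, h.rhoTerm_eq, h.rhoInit_eq, hw.1, inner_zero_left, inner_zero_left]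
    linarith
  · rw [action_of_not_isAdmissible hw]
    exact le_top

/-- The easy half of the Fenchel–Young duality of subdifferentials. -/
theorem mem_subdiff_conjugate_of_mem_subdiff {f : State Ω → EReal} {q u : State Ω}
    (h : q ∈ subdiff f u) : u ∈ subdiff (conjugate f) q := by
  obtain ⟨h1, h2, h3⟩ := h
  obtain ⟨r, hr⟩ : ∃ r : ℝ, f u = r := ⟨_, (EReal.coe_toReal h1 h2).symm⟩
  have hle : ∀ p : State Ω, ((pairing p u - r : ℝ) : EReal) ≤ conjugate f p := fun p => by
    refine le_of_eq_of_le ?_ (le_iSup _ u)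
    rw [hr, EReal.coe_sub]
  have heq : conjugate f q = ((pairing q u - r : ℝ) : EReal) := by
    refine le_antisymm (iSup_le fun w => ?_) (hle q)
    refine EReal.sub_le_of_le_add ?_
    refine le_trans ?_ (add_le_add_right (h3 w) _)
    rw [hr, ← EReal.coe_add, ← EReal.coe_add, EReal.coe_le_coe_iff, pairing_sub_right]
    linarith
  refine ⟨by rw [heq]; exact EReal.coe_ne_top _, by rw [heq]; exact EReal.coe_ne_bot _,
    fun p => le_trans ?_ (hle p)⟩
  rw [heq, ← EReal.coe_add, EReal.coe_le_coe_iff, pairing_sub_right, pairing_comm u,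
    pairing_comm u]
  linarith

theorem mem_subdiff_action_iff_isOptimalPair (hH : IsConvexDifferentiable Ω H)
    (hHmeas : ∀ p, AEMeasurable (fun z : Space d × ℝ => H z.2 z.1 p) (cylMeasure Ω))
    {q u : State Ω} : q ∈ subdiff (action H ρ₀) u ↔ IsOptimalPair H ρ₀ q u :=
  ⟨fun h => isOptimalPair_of_mem_subdiff_conjugate hH hHmeas
    (mem_subdiff_conjugate_of_mem_subdiff h), fun h => h.mem_subdiff hH⟩

theorem mem_subdiff_conjugate_iff_isOptimalPair (hH : IsConvexDifferentiable Ω H)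
    (hHmeas : ∀ p, AEMeasurable (fun z : Space d × ℝ => H z.2 z.1 p) (cylMeasure Ω))
    {q u : State Ω} : u ∈ subdiff (conjugate (action H ρ₀)) q ↔ IsOptimalPair H ρ₀ q u :=
  ⟨isOptimalPair_of_mem_subdiff_conjugate hH hHmeas,
    fun h => mem_subdiff_conjugate_of_mem_subdiff (h.mem_subdiff hH)⟩

/-! ### The optimization problem in terms of the operator `C` -/

section Problem

variable {r : ℕ} {ζ : Fin r → Space d → ℝ} (hζ : ∀ i, MemLp (ζ i) 2 (spaceMeasure Ω))
  (s : Param Ω r)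

theorem coeFn_add_sum_tensor :
    ∀ᵐ z ∂(cylMeasure Ω), (s.alpha + ∑ i, tensor (hζ i) (s.a i) : L2Q Ω) z
      = s.alpha z + ∑ i, s.a i z.2 * ζ i z.1 := by
  have h : ∀ᵐ z ∂(cylMeasure Ω), ∀ i, tensor (hζ i) (s.a i) z = s.a i z.2 * ζ i z.1 :=
    ae_all_iff.2 fun i => (memLp_tensor (s.a i) (hζ i)).coeFn_toLp
  filter_upwards [Lp.coeFn_add s.alpha (∑ i, tensor (hζ i) (s.a i)),
    Lp.coeFn_fun_finsetSum Finset.univ (fun i => tensor (hζ i) (s.a i)), h] with z h1 h2 h3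
  rw [h1, Pi.add_apply, h2]
  simp only [h3]

theorem coeFn_add_sum_smul :
    ∀ᵐ x ∂(spaceMeasure Ω), (s.beta + ∑ i, s.b i • (hζ i).toLp (ζ i) : L2X Ω) x
      = s.beta x + ∑ i, s.b i * ζ i x := by
  have h : ∀ᵐ x ∂(spaceMeasure Ω), ∀ i, (s.b i • (hζ i).toLp (ζ i) : L2X Ω) x = s.b i * ζ i x := by
    refine ae_all_iff.2 fun i => ?_
    filter_upwards [Lp.coeFn_smul (s.b i) ((hζ i).toLp (ζ i)), (hζ i).coeFn_toLp] with x h1 h2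
    rw [h1, Pi.smul_apply, h2, smul_eq_mul]
  filter_upwards [Lp.coeFn_add s.beta (∑ i, s.b i • (hζ i).toLp (ζ i)),
    Lp.coeFn_fun_finsetSum Finset.univ (fun i => s.b i • (hζ i).toLp (ζ i)), h] with x h1 h2 h3
  rw [h1, Pi.add_apply, h2]
  simp only [h3]

theorem opC_rho : (opC hζ s).rho = -(s.alpha + ∑ i, tensor (hζ i) (s.a i)) - H1.dt s.phi := by
  change -(∑ i, tensor (hζ i) (s.a i)) - s.alpha - H1.dt s.phi = _
  abel

theorem opC_rhoTerm :
    (opC hζ s).rhoTerm = H1.terminal s.phi - (s.beta + ∑ i, s.b i • (hζ i).toLp (ζ i)) := by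
  change -(∑ i, s.b i • (hζ i).toLp (ζ i)) - s.beta + H1.terminal s.phi = _
  abel

theorem coeFn_opC_rho :
    ∀ᵐ z ∂(cylMeasure Ω), (opC hζ s).rho z
      = -(s.alpha z + ∑ i, s.a i z.2 * ζ i z.1) - H1.dt s.phi z := by
  rw [opC_rho]
  filter_upwards [coeFn_add_sum_tensor hζ s,
    Lp.coeFn_sub (-(s.alpha + ∑ i, tensor (hζ i) (s.a i))) (H1.dt s.phi),
    Lp.coeFn_neg (s.alpha + ∑ i, tensor (hζ i) (s.a i))] with z h1 h2 h3
  rw [h2, Pi.sub_apply, h3, Pi.neg_apply, h1]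

theorem coeFn_neg_opC_flux :
    ∀ᵐ z ∂(cylMeasure Ω), -(opC hζ s).flux z = H1.grad s.phi z := by
  filter_upwards [Lp.coeFn_neg (H1.grad s.phi)] with z hz
  change -((-H1.grad s.phi : L2QV Ω) z) = _
  rw [hz, Pi.neg_apply, neg_neg]

theorem opC_rhoTerm_eq_zero_iff :
    (opC hζ s).rhoTerm = 0 ↔
      ∀ᵐ x ∂(spaceMeasure Ω), H1.terminal s.phi x = s.beta x + ∑ i, s.b i * ζ i x := by
  rw [opC_rhoTerm, sub_eq_zero, Lp.ext_iff]
  constructor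
  · intro h
    filter_upwards [h, coeFn_add_sum_smul hζ s] with x h1 h2
    rw [h1, h2]
  · intro h
    filter_upwards [h, coeFn_add_sum_smul hζ s] with x h1 h2
    rw [h1, h2]

/-- For `q = C(a,b,α,β,φ)` one has `-m̂ = ∇φ` and `ρ̂ = -(α + ∑ aᵢζᵢ) - φ_t`, so the dual constraint
is the Hamilton–Jacobi inequality and `ρ̂(·,1) = 0` the terminal condition. -/
theorem isOptimalPair_opC_iff {u : State Ω} :
    IsOptimalPair H ρ₀ (opC hζ s) u ↔
      (∀ᵐ z ∂(cylMeasure Ω), 0 ≤ u.rho z) ∧ SolvesComplementaritySystem H ρ₀ ζ s u := by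
  constructor
  · rintro ⟨h1, h2, h3, h4, h5, h6⟩
    refine ⟨h1, ?_, ?_, ?_, h5, (opC_rhoTerm_eq_zero_iff hζ s).1 h6⟩
    · filter_upwards [h2, coeFn_opC_rho hζ s, coeFn_neg_opC_flux hζ s] with z hz hr hf
      rw [hr, hf] at hz
      linarith
    · filter_upwards [h3, coeFn_opC_rho hζ s, coeFn_neg_opC_flux hζ s] with z hz hr hf hpos
      rw [hr, hf] at hz
      linarith [hz hpos]
    · filter_upwards [h4, coeFn_neg_opC_flux hζ s] with z hz hf
      rw [hz, hf]
  · rintro ⟨h1, h2, h3, h4, h5, h6⟩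
    refine ⟨h1, ?_, ?_, ?_, h5, (opC_rhoTerm_eq_zero_iff hζ s).2 h6⟩
    · filter_upwards [h2, coeFn_opC_rho hζ s, coeFn_neg_opC_flux hζ s] with z hz hr hf
      rw [hr, hf]
      linarith
    · filter_upwards [h3, coeFn_opC_rho hζ s, coeFn_neg_opC_flux hζ s] with z hz hr hf hpos
      rw [hr, hf]
      linarith [hz hpos]
    · filter_upwards [h4, coeFn_neg_opC_flux hζ s] with z hz hf
      rw [hz, hf]

theorem objective_eq (u : State Ω) :
    objective H ρ₀ ζ s u = action H ρ₀ u + ((-pairing (opC hζ s) u : ℝ) : EReal) := by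
  have h1 : ∫ z, (s.alpha z + ∑ i, s.a i z.2 * ζ i z.1) * u.rho z ∂(cylMeasure Ω)
      = inner ℝ (s.alpha + ∑ i, tensor (hζ i) (s.a i)) u.rho := by
    rw [L2Q.inner_eq]
    refine integral_congr_ae ?_
    filter_upwards [coeFn_add_sum_tensor hζ s] with z hz
    rw [hz]
  have h2 : ∫ x, (s.beta x + ∑ i, s.b i * ζ i x) * u.rhoTerm x ∂(spaceMeasure Ω)
      = inner ℝ (s.beta + ∑ i, s.b i • (hζ i).toLp (ζ i)) u.rhoTerm := by
    rw [L2X.inner_eq]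
    refine integral_congr_ae ?_
    filter_upwards [coeFn_add_sum_smul hζ s] with x hx
    rw [hx]
  have hrho := opC_rho hζ s
  have hflux : (opC hζ s).flux = -H1.grad s.phi := rfl
  have hinit : (opC hζ s).rhoInit = -H1.initial s.phi := rfl
  have hterm := opC_rhoTerm hζ s
  generalize opC hζ s = q at hrho hflux hinit hterm ⊢
  unfold objective
  rw [h1, h2, integral_mul_add_inner, ← L2X.inner_eq, ← L2X.inner_eq, pairing_eq_inner, hrho,
    hflux, hinit, hterm]
  congr 2
  simp only [inner_sub_left, inner_neg_left]
  ring

theorem Psi_eq_neg_conjugate :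
    Psi H ρ₀ ζ s = -conjugate (action H ρ₀) (opC hζ s) := by
  have h : ∀ u, objective H ρ₀ ζ s u
      = -(((pairing (opC hζ s) u : ℝ) : EReal) - action H ρ₀ u) := fun u => by
    rw [objective_eq hζ s u, EReal.neg_sub (.inl (EReal.coe_ne_bot _)) (.inl (EReal.coe_ne_top _)),
      add_comm, EReal.coe_neg]
  unfold Psi conjugate
  simp only [h]
  refine le_antisymm ?_ ?_
  · rw [EReal.le_neg]
    exact iSup_le fun u => EReal.le_neg.1 (iInf_le _ u)
  · exact le_iInf fun u => EReal.neg_le_neg_iff.2 (le_iSup (fun u : State Ω =>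
      ((pairing (opC hζ s) u : ℝ) : EReal) - action H ρ₀ u) u)

theorem isSolution_iff_mem_subdiff (hH : IsConvexDifferentiable Ω H)
    (hHfin : ∃ p : L2QV Ω, MemLp (fun z => H z.2 z.1 (p z)) 2 (cylMeasure Ω)) {u : State Ω} :
    IsSolution H ρ₀ ζ s u ↔ opC hζ s ∈ subdiff (action H ρ₀) u := by
  have hbot : ∀ w, action H ρ₀ w ≠ ⊥ := action_ne_bot hHfin
  have hobj := objective_eq (H := H) (ρ₀ := ρ₀) hζ s
  have hzero : action H ρ₀ (0, 0, ρ₀, 0) = 0 := action_zero_density hH 0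
  unfold IsSolution
  generalize opC hζ s = q at hobj ⊢
  have key : action H ρ₀ u ≠ ⊤ → ∀ w, objective H ρ₀ ζ s u ≤ objective H ρ₀ ζ s w ↔
      action H ρ₀ u + ((pairing q (w - u) : ℝ) : EReal) ≤ action H ρ₀ w := by
    intro hu w
    obtain ⟨r, hr⟩ : ∃ r : ℝ, action H ρ₀ u = r := ⟨_, (EReal.coe_toReal hu (hbot u)).symm⟩
    rw [hobj u, hobj w, hr, pairing_sub_right]
    by_cases hw : action H ρ₀ w = ⊤
    · simp [hw]
    · obtain ⟨r', hr'⟩ : ∃ r' : ℝ, action H ρ₀ w = r' := ⟨_, (EReal.coe_toReal hw (hbot w)).symm⟩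
      rw [hr', ← EReal.coe_add, ← EReal.coe_add, ← EReal.coe_add, EReal.coe_le_coe_iff,
        EReal.coe_le_coe_iff]
      constructor <;> intro <;> linarith
  constructor
  · intro h
    -- A minimizer does at least as well as the vacuum state, whose objective is finite.
    have hu : action H ρ₀ u ≠ ⊤ := by
      intro hu
      have h0 := h (0, 0, ρ₀, 0)
      rw [hobj u, hobj, hzero, hu, zero_add, EReal.top_add_coe, top_le_iff] at h0
      exact EReal.coe_ne_top _ h0
    exact ⟨hu, hbot u, fun w => (key hu w).1 (h w)⟩
  · exact fun h w => (key h.1 w).2 (h.2.2 w)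

end Problem

/-! ### Equation versus complementarity form, and the main theorem -/

theorem SolvesSystem.solvesComplementaritySystem {r : ℕ} {ζ : Fin r → Space d → ℝ}
    {s : Param Ω r} {u : State Ω} (h : SolvesSystem H ρ₀ ζ s u) :
    SolvesComplementaritySystem H ρ₀ ζ s u :=
  ⟨h.1.mono fun _ hz => hz.le, h.1.mono fun _ hz _ => hz, h.2⟩

theorem SolvesComplementaritySystem.solvesSystem {r : ℕ} {ζ : Fin r → Space d → ℝ}
    {s : Param Ω r} {u : State Ω} (h : SolvesComplementaritySystem H ρ₀ ζ s u)
    (hu : ∀ᵐ z ∂(cylMeasure Ω), 0 < u.rho z) : SolvesSystem H ρ₀ ζ s u :=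
  ⟨by filter_upwards [h.2.1, hu] with z hz hpos using hz hpos, h.2.2⟩

end MFG

theorem mainTheorem2 {d r : ℕ} (Ω : Set (MFG.Space d)) (hΩ : IsOpen Ω)
    (H : ℝ → MFG.Space d → MFG.Space d → ℝ)
    (hHmeas : ∀ p, AEMeasurable (fun z : MFG.Space d × ℝ => H z.2 z.1 p) (cylMeasure Ω))
    (hHconv : ∀ t ∈ Ioo (0 : ℝ) 1, ∀ x ∈ Ω, ConvexOn ℝ univ (H t x))
    (hHdiff : ∀ t ∈ Ioo (0 : ℝ) 1, ∀ x ∈ Ω, Differentiable ℝ (H t x))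
    (hHfin : ∃ p : L2QV Ω, MemLp (fun z => H z.2 z.1 (p z)) 2 (cylMeasure Ω))
    (ρ₀ : L2X Ω)
    (ζ : Fin r → MFG.Space d → ℝ) (hζC2 : ∀ i, ContDiffOn ℝ 2 (ζ i) Ω)
    (hζ : ∀ i, MemLp (ζ i) 2 (spaceMeasure Ω))
    (hζorth : Orthonormal ℝ (fun i => (hζ i).toLp (ζ i)))
    (s : Param Ω r) :
    -- a nonnegative solution of the system is a minimizer
    (∀ u : State Ω, (∀ᵐ z ∂(cylMeasure Ω), 0 ≤ u.rho z) →
      SolvesSystem H ρ₀ ζ s u → IsSolution H ρ₀ ζ s u) ∧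
    -- for positive densities the system characterizes minimizers
    (∀ u : State Ω, (∀ᵐ z ∂(cylMeasure Ω), 0 < u.rho z) →
      (SolvesSystem H ρ₀ ζ s u ↔ IsSolution H ρ₀ ζ s u)) ∧
    -- characterization of all minimizers, where the density may vanish
    (∀ u : State Ω, IsSolution H ρ₀ ζ s u ↔
      (∀ᵐ z ∂(cylMeasure Ω), 0 ≤ u.rho z) ∧ SolvesComplementaritySystem H ρ₀ ζ s u) ∧
    -- duality
    Psi H ρ₀ ζ s = -conjugate (action H ρ₀) (opC hζ s) ∧
    (∀ u : State Ω, IsSolution H ρ₀ ζ s u ↔ opC hζ s ∈ subdiff (action H ρ₀) u) ∧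
    (∀ u : State Ω, IsSolution H ρ₀ ζ s u ↔
      u ∈ subdiff (conjugate (action H ρ₀)) (opC hζ s)) := by
  have hH := isConvexDifferentiable_of_forall hΩ hHconv hHdiff
  have hsub : ∀ u : State Ω, IsSolution H ρ₀ ζ s u ↔ opC hζ s ∈ subdiff (action H ρ₀) u :=
    fun u => isSolution_iff_mem_subdiff hζ s hH hHfin
  have hopt : ∀ u : State Ω, IsSolution H ρ₀ ζ s u ↔ IsOptimalPair H ρ₀ (opC hζ s) u :=
    fun u => (hsub u).trans (mem_subdiff_action_iff_isOptimalPair hH hHmeas)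
  have hcomp : ∀ u : State Ω, IsSolution H ρ₀ ζ s u ↔
      (∀ᵐ z ∂(cylMeasure Ω), 0 ≤ u.rho z) ∧ SolvesComplementaritySystem H ρ₀ ζ s u :=
    fun u => (hopt u).trans (isOptimalPair_opC_iff hζ s)
  refine ⟨fun u hu hs => (hcomp u).2 ⟨hu, hs.solvesComplementaritySystem⟩, fun u hu => ⟨?_, ?_⟩,
    hcomp, Psi_eq_neg_conjugate hζ s, hsub,
    fun u => (hopt u).trans (mem_subdiff_conjugate_iff_isOptimalPair hH hHmeas).symm⟩
  · exact fun hs => (hcomp u).2 ⟨hu.mono fun _ hz => hz.le, hs.solvesComplementaritySystem⟩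
  · exact fun hs => ((hcomp u).1 hs).2.solvesSystem hu
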